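/- Let $n\ge 0$ be an integer, let $S^1=\mathbb{R}/2\pi\mathbb{Z}$, and for $t\ge 0$ let $Q(t)=S^1\times[-t,t]$ carry the flat metric $d\theta^2+dt^2$. For $1<p<2$, $R>0$ and $T>0$ let $\mathcal{F}^p_{conf}(Q(T),R)$ be the set of maps $f$ from $Q(T)$ to $\mathbb{R}^n$ such that (1) $f\in W^{2,p}_{loc}$ on the interior $S^1\times(-T,T)$ of $Q(T)$; (2) $|f|\le R$ almost everywhere; (3) $|\Delta f|\le\beta\,|\nabla f|^2$ almost everywhere, for some nonnegative measurable function $\beta$ with $\int_{Q(T)}\beta^2|\nabla f|^2<\infty$; (4) $f$ is weakly conformal, i.e. $\sum_{j=1}^n(\partial f^j/\partial z)^2=0$ almost everywhere, where $z=\theta+it$. Put $H(f)=2\Delta f/|\nabla f|^2$ where $\nabla f\neq 0$ and $H(f)=0$ elsewhere, and for measurable $A\subset Q(T)$ let $$W(f,A)=\frac14\int_A|H(f)|^2|\nabla f|^2,\qquad E(f,A)=\int_A|\nabla f|^2\in[0,\infty].$$ Let $1<p<2$. There is a constant $C>0$, depending only on $n$ and $p$, such that for every $\epsilon_0>0$ there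 is $\epsilon_2\in(0,\epsilon_0)$, depending only on $n$, $p$ and $\epsilon_0$, with the following property. If $R>0$, $T\ge 1$, $f\in\mathcal{F}^p_{conf}(Q(T),R)$, $\epsilon>0$ and $$\sup_{t\in[-T,T-1]}W(f,S^1\times[t,t+1])<\epsilon^2\le\epsilon_2^2,$$ then for all $t\in[0,T]$ $$\int_{Q(t)}|\nabla f|^2\le C\,E(f,Q(T))\,e^{-(1-C\epsilon)(T-t)},$$ and the inequality is strict if $0<E(f,Q(T))<\infty$. -/

import Mathlib

open MeasureTheory Set
open scoped ENNReal ContDiff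

noncomputable section

namespace WillmoreCyl

instance factTwoPiPos : Fact ((0 : ℝ) < 2 * Real.pi) := ⟨Real.two_pi_pos⟩

/-- The infinite cylinder `S¹ × ℝ`, where `S¹ = ℝ / 2πℤ`, with the flat metric `dθ² + dt²`;
its area measure is the product measure `dθ dt`, so that `S¹` has length `2π`. -/
abbrev Cyl : Type := AddCircle (2 * Real.pi) × ℝ

/-- The closed cylinder `Q(t) = S¹ × [-t, t]`. -/
def Q (t : ℝ) : Set Cyl := univ ×ˢ Icc (-t) t

/-- The interior `S¹ × (-t, t)` of `Q(t)`. -/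
def Qo (t : ℝ) : Set Cyl := univ ×ˢ Ioo (-t) t

/-- Translation by `s` in the direction of `∂_θ` (`i = 0`) or of `∂_t` (`i = 1`). -/
def shift (i : Fin 2) (s : ℝ) : Cyl := if i = 0 then ((s : AddCircle (2 * Real.pi)), 0) else (0, s)

/-- The classical partial derivative `∂_θ φ` (`i = 0`) or `∂_t φ` (`i = 1`). -/
def partialDeriv (i : Fin 2) (φ : Cyl → ℝ) (x : Cyl) : ℝ :=
  deriv (fun s : ℝ => φ (x + shift i s)) 0

/-- Test functions on an open subset `U` of the cylinder: smooth functions (in the coordinates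
`(θ, t)`) whose support is compact and contained in `U`. -/
structure IsTest (U : Set Cyl) (φ : Cyl → ℝ) : Prop where
  smooth : ContDiff ℝ ∞ (fun y : ℝ × ℝ => φ ((y.1 : AddCircle (2 * Real.pi)), y.2))
  compact : HasCompactSupport φ
  subset : tsupport φ ⊆ U

variable {n : ℕ}

/-- `g` is a weak partial derivative of `f` on `U` in the direction `i`. -/
structure IsWeakPartial (U : Set Cyl) (i : Fin 2) (f g : Cyl → EuclideanSpace ℝ (Fin n)) :
    Prop where
  locInt : LocallyIntegrableOn f U
  locInt_deriv : LocallyIntegrableOn g U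
  byParts : ∀ φ : Cyl → ℝ, IsTest U φ →
    ∫ x, partialDeriv i φ x • f x = - ∫ x, φ x • g x

/-- `f ∈ L^p_loc(U)`. -/
def MemLpLoc (p : ℝ≥0∞) (U : Set Cyl) (f : Cyl → EuclideanSpace ℝ (Fin n)) : Prop :=
  ∀ K : Set Cyl, IsCompact K → K ⊆ U → MemLp f p (volume.restrict K)

/-- `f ∈ W^{k,p}_loc(U)`. -/
def MemSobolevLoc (p : ℝ≥0∞) (U : Set Cyl) :
    ℕ → (Cyl → EuclideanSpace ℝ (Fin n)) → Prop
  | 0, f => MemLpLoc p U f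
  | k + 1, f => MemLpLoc p U f ∧
      ∀ i : Fin 2, ∃ g, IsWeakPartial U i f g ∧ MemSobolevLoc p U k g

open Classical in
/-- The weak partial derivative of `f` on `U`, which is unique up to null sets if it exists
(and set to zero if it does not exist). -/
def weakPartial (U : Set Cyl) (i : Fin 2) (f : Cyl → EuclideanSpace ℝ (Fin n)) :
    Cyl → EuclideanSpace ℝ (Fin n) :=
  if h : ∃ g, IsWeakPartial U i f g then h.choose else 0

/-- `|∇f|² = |∂_θ f|² + |∂_t f|²`. -/
def gradSq (U : Set Cyl) (f : Cyl → EuclideanSpace ℝ (Fin n)) (x : Cyl) : ℝ :=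
  ∑ i : Fin 2, ‖weakPartial U i f x‖ ^ 2

/-- `Δf = ∂_θ ∂_θ f + ∂_t ∂_t f`. -/
def lap (U : Set Cyl) (f : Cyl → EuclideanSpace ℝ (Fin n)) (x : Cyl) :
    EuclideanSpace ℝ (Fin n) :=
  ∑ i : Fin 2, weakPartial U i (weakPartial U i f) x

open Classical in
/-- `H(f) = 2 Δf / |∇f|²` where `∇f ≠ 0`, and `H(f) = 0` elsewhere. -/
def meanCurv (U : Set Cyl) (f : Cyl → EuclideanSpace ℝ (Fin n)) (x : Cyl) :
    EuclideanSpace ℝ (Fin n) :=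
  if gradSq U f x ≠ 0 then (2 / gradSq U f x) • lap U f x else 0

/-- The Dirichlet energy `E(f, A) = ∫_A |∇f|²`, with values in `[0, ∞]`. -/
def energy (U : Set Cyl) (f : Cyl → EuclideanSpace ℝ (Fin n)) (A : Set Cyl) : ℝ≥0∞ :=
  ∫⁻ x in A, ENNReal.ofReal (gradSq U f x)

/-- The Willmore energy `W(f, A) = 1/4 ∫_A |H(f)|² |∇f|²`, with values in `[0, ∞]`. -/
def willmore (U : Set Cyl) (f : Cyl → EuclideanSpace ℝ (Fin n)) (A : Set Cyl) : ℝ≥0∞ :=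
  (1 / 4) * ∫⁻ x in A, ENNReal.ofReal (‖meanCurv U f x‖ ^ 2 * gradSq U f x)

/-- The class `𝓕^p(U, dθ² + dt², R)` of maps into `ℝⁿ`. -/
structure MemF (p : ℝ≥0∞) (U : Set Cyl) (R : ℝ) (f : Cyl → EuclideanSpace ℝ (Fin n)) :
    Prop where
  sobolev : MemSobolevLoc p U 2 f
  bounded : ∀ᵐ x ∂(volume.restrict U), ‖f x‖ ≤ R
  laplace : ∃ β : Cyl → ℝ, Measurable β ∧ (∀ x, 0 ≤ β x) ∧
    (∀ᵐ x ∂(volume.restrict U), ‖lap U f x‖ ≤ β x * gradSq U f x) ∧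
    ∫⁻ x in U, ENNReal.ofReal (β x ^ 2 * gradSq U f x) < ⊤

/-- The components of `∂f/∂z = (∂_θ f - i ∂_t f) / 2` in the complex coordinate `z = θ + i t`. -/
def dz (U : Set Cyl) (f : Cyl → EuclideanSpace ℝ (Fin n)) (x : Cyl) (j : Fin n) : ℂ :=
  ((weakPartial U 0 f x j : ℂ) - Complex.I * (weakPartial U 1 f x j : ℂ)) / 2

/-- The class `𝓕^p_conf(U, dθ² + dt², R)`: in addition `∂f ⊗ ∂f = 0` almost everywhere, that is,
`∑ⱼ (∂fʲ/∂z)² = 0`. -/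
structure MemFConf (p : ℝ≥0∞) (U : Set Cyl) (R : ℝ) (f : Cyl → EuclideanSpace ℝ (Fin n)) :
    Prop where
  memF : MemF p U R f
  conformal : ∀ᵐ x ∂(volume.restrict U), ∑ j : Fin n, dz U f x j ^ 2 = 0

end WillmoreCyl

end

/-! Write `D` for `∂_θ f` and `L` for `Δf`. Conformality gives `|∂_t f| = |D|` almost everywhere, so
`|∇f|² = 2|D|²` and it suffices to bound `D`. As a derivative in `θ`, `D` has mean zero on circles,
and its Fourier modes with `k ≠ 0` solve `y'' - k² y = ±k v`, where `v` is the conjugate mode of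
`L`. The Green function of `y'' - k² y` is `-e^{-|k||t-s|}/(2|k|)`. Its denominator cancels the
factor `k` on the right, so after a cut-off `η` in `t` the mode is bounded by the potential with
kernel `e^{-|k||t-s|}` of `|η| ∫|L| dθ` plus terms containing `η'` and `η''`
(`enorm_cutoff_mul_le_green`). Squaring, summing over `k` by Parseval and summing over the
components bounds the cut-off circle energy by a square function of potentials
(`circle_energy_le_expPot`).

Put `a(t) = ∫|D|² dθ` and `b(t) = ∫|L|²/|D|² dθ`. By Cauchy-Schwarz `∫|L| dθ ≤ b^{1/2} a^{1/2}`, and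
the integral of `b` over a unit interval is at most twice a local Willmore energy, hence small. One
would like to absorb this term, but the square function is not bounded from `L¹` to `L²`: a unit
point mass contributes about `1/k` for each `k`. It is bounded on Morrey densities: if `∫_I g ≤ G
ρ^α` on all intervals of length `ρ ≤ 1`, with `0 < α < 1/2`, then the integral of the square
function over such an interval is at most a constant times `G² ρ^{2α}`
(`tsum_lintegral_expPot_sq_le`). The term `b^{1/2} a^{1/2}` maps the Morrey bound for `a` with
exponent `2α` back to exponent `α` with a small factor, so it can be absorbed provided the Morrey
norm is known to be finite. Finiteness comes from `Δf ∈ L^p_loc` and Hölder, with `α = 1 - 1/p`;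
here `1 < p < 2` is exactly `0 < α < 1/2`.

Decay comes from running the absorption with the weight `e^{-|s-τ|/2}`
(`exp_decay_of_potential_bound`). As `|k| ≥ 1`, half of the kernel pays for moving the weight onto
the density. Only the cut-off terms near the ends remain, where the squared weight is about
`e^{-(T-|τ|)}`. This yields the rate `e^{-(T-t)}` itself, which is stronger than the rate with the
loss `Cε`; smallness of the Willmore energy enters only in the absorption. -/

noncomputable section

namespace WillmoreCyl

/-! ### Green representation in one variable -/

/-- The kernel `e^{-κ(s-t)}` for `t ≤ s`, and zero otherwise. -/
def kerLeft (κ s t : ℝ) : ℝ := if t ≤ s then Real.exp (-κ * (s - t)) else 0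

/-- The kernel `e^{-κ(t-s)}` for `s < t`, and zero otherwise. -/
def kerRight (κ s t : ℝ) : ℝ := if s < t then Real.exp (-κ * (t - s)) else 0

lemma measurable_kerLeft (κ : ℝ) : Measurable (fun z : ℝ × ℝ => kerLeft κ z.1 z.2) := by
  unfold kerLeft
  exact Measurable.ite (measurableSet_le measurable_snd measurable_fst) (by fun_prop) (by fun_prop)

lemma measurable_kerRight (κ : ℝ) : Measurable (fun z : ℝ × ℝ => kerRight κ z.1 z.2) := by
  unfold kerRight
  exact Measurable.ite (measurableSet_lt measurable_fst measurable_snd) (by fun_prop) (by fun_prop)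

lemma kerLeft_nonneg (κ s t : ℝ) : 0 ≤ kerLeft κ s t := by
  unfold kerLeft; split_ifs <;> positivity

lemma kerRight_nonneg (κ s t : ℝ) : 0 ≤ kerRight κ s t := by
  unfold kerRight; split_ifs <;> positivity

/-- The kernel is split at its corner because its derivative has opposite signs on the two sides, so
that derivative terms enter the Green representation differently on each half. -/
lemma kerLeft_add_kerRight (κ s t : ℝ) :
    kerLeft κ s t + kerRight κ s t = Real.exp (-κ * |t - s|) := by
  unfold kerLeft kerRight
  rcases le_or_gt t s with h | h
  · rw [if_pos h, if_neg (not_lt.2 h), abs_of_nonpos (by linarith), add_zero]; congr 1; ring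
  · rw [if_neg (not_le.2 h), if_pos h, abs_of_pos (by linarith), zero_add]

lemma exp_neg_mul_abs_le_one {κ : ℝ} (hκ : 0 ≤ κ) (x : ℝ) : Real.exp (-κ * |x|) ≤ 1 := by
  rw [Real.exp_le_one_iff]; nlinarith [abs_nonneg x]

lemma kerLeft_le_one {κ : ℝ} (hκ : 0 ≤ κ) (s t : ℝ) : kerLeft κ s t ≤ 1 := by
  have := kerLeft_add_kerRight κ s t
  linarith [kerRight_nonneg κ s t, exp_neg_mul_abs_le_one hκ (t - s)]

lemma kerRight_le_one {κ : ℝ} (hκ : 0 ≤ κ) (s t : ℝ) : kerRight κ s t ≤ 1 := by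
  have := kerLeft_add_kerRight κ s t
  linarith [kerLeft_nonneg κ s t, exp_neg_mul_abs_le_one hκ (t - s)]

/-- Fubini for a bounded kernel. -/
lemma integral_kernel_swap {k : ℝ → ℝ → ℝ} (hk : Measurable (fun z : ℝ × ℝ => k z.1 z.2))
    (hk1 : ∀ s t, |k s t| ≤ 1) {χ m : ℝ → ℝ} (hχ : Integrable χ) (hm : Integrable m) :
    ∫ s, (∫ t, k s t * χ t) * m s = ∫ t, χ t * ∫ s, k s t * m s := by
  have hint : Integrable (fun z : ℝ × ℝ => k z.1 z.2 * (m z.1 * χ z.2)) (volume.prod volume) :=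
    (hm.mul_prod hχ).bdd_mul (c := 1) hk.aestronglyMeasurable
      (Filter.Eventually.of_forall fun z => by simpa using hk1 z.1 z.2)
  calc ∫ s, (∫ t, k s t * χ t) * m s
      = ∫ s, ∫ t, k s t * (m s * χ t) := by
        congr 1; ext s; rw [← integral_mul_const]; congr 1; ext t; ring
    _ = ∫ t, ∫ s, k s t * (m s * χ t) := integral_integral_swap hint
    _ = ∫ t, χ t * ∫ s, k s t * m s := by
        congr 1; ext t; rw [← integral_const_mul]; congr 1; ext s; ring

lemma locallyIntegrable_kernel_integral {k : ℝ → ℝ → ℝ}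
    (hk : Measurable (fun z : ℝ × ℝ => k z.1 z.2))
    (hk1 : ∀ s t, |k s t| ≤ 1) {m : ℝ → ℝ} (hm : Integrable m) :
    LocallyIntegrable (fun t => ∫ s, k s t * m s) := by
  refine MemLp.locallyIntegrable (p := ⊤) (memLp_top_of_bound ?_ (∫ s, ‖m s‖) ?_) le_top
  · have h : AEStronglyMeasurable (fun z : ℝ × ℝ => k z.2 z.1 * m z.2) (volume.prod volume) :=
      (hk.comp measurable_swap).aestronglyMeasurable.mul hm.aestronglyMeasurable.comp_snd
    exact h.integral_prod_right'
  · refine Filter.Eventually.of_forall fun t => ?_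
    refine norm_integral_le_of_norm_le hm.norm (Filter.Eventually.of_forall fun s => ?_)
    rw [norm_mul]
    exact mul_le_of_le_one_left (norm_nonneg _) (hk1 s t)

lemma hasDerivAt_integral_Iic {g : ℝ → ℝ} (hg : Continuous g) (hi : Integrable g) (s : ℝ) :
    HasDerivAt (fun s => ∫ t in Iic s, g t) (g s) s := by
  have h : (fun s => ∫ t in Iic s, g t) = fun s => (∫ t in Iic (0:ℝ), g t) + ∫ t in (0:ℝ)..s, g t := by
    ext s
    rw [← intervalIntegral.integral_Iic_sub_Iic hi.integrableOn hi.integrableOn]; ring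
  rw [h]
  exact (intervalIntegral.integral_hasDerivAt_right (hg.intervalIntegrable _ _)
    (hg.stronglyMeasurableAtFilter _ _) hg.continuousAt).const_add _

lemma hasDerivAt_integral_Ioi {g : ℝ → ℝ} (hg : Continuous g) (hi : Integrable g) (s : ℝ) :
    HasDerivAt (fun s => ∫ t in Ioi s, g t) (-g s) s := by
  have h : (fun s => ∫ t in Ioi s, g t) = fun s => (∫ t, g t) - ∫ t in Iic s, g t := by
    ext s
    rw [← integral_add_compl (measurableSet_Iic (a := s)) hi, compl_Iic]; ring
  rw [h]
  exact (hasDerivAt_integral_Iic hg hi s).const_sub _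

/-- The left half of the convolution of `χ` with `e^{-κ|·|}`. -/
def convLeft (κ : ℝ) (χ : ℝ → ℝ) (s : ℝ) : ℝ := ∫ t, kerLeft κ s t * χ t

/-- The right half of the convolution of `χ` with `e^{-κ|·|}`. -/
def convRight (κ : ℝ) (χ : ℝ → ℝ) (s : ℝ) : ℝ := ∫ t, kerRight κ s t * χ t

lemma convLeft_eq (κ : ℝ) (χ : ℝ → ℝ) (s : ℝ) :
    convLeft κ χ s = Real.exp (-κ * s) * ∫ t in Iic s, Real.exp (κ * t) * χ t := by
  rw [convLeft, ← integral_const_mul, ← integral_indicator measurableSet_Iic]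
  congr 1; ext t
  by_cases h : t ≤ s
  · rw [kerLeft, if_pos h, indicator_of_mem (by exact h), ← mul_assoc, ← Real.exp_add]
    congr 2; ring
  · rw [kerLeft, if_neg h, indicator_of_notMem (by exact h), zero_mul]

lemma convRight_eq (κ : ℝ) (χ : ℝ → ℝ) (s : ℝ) :
    convRight κ χ s = Real.exp (κ * s) * ∫ t in Ioi s, Real.exp (-κ * t) * χ t := by
  rw [convRight, ← integral_const_mul, ← integral_indicator measurableSet_Ioi]
  congr 1; ext t
  by_cases h : s < t
  · rw [kerRight, if_pos h, indicator_of_mem (by exact h), ← mul_assoc, ← Real.exp_add]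
    congr 2; ring
  · rw [kerRight, if_neg h, indicator_of_notMem (by exact h), zero_mul]

lemma hasDerivAt_convLeft (κ : ℝ) {χ : ℝ → ℝ} (hχ : Continuous χ) (hc : HasCompactSupport χ)
    (s : ℝ) : HasDerivAt (convLeft κ χ) (-κ * convLeft κ χ s + χ s) s := by
  have hcont : Continuous fun t => Real.exp (κ * t) * χ t := by fun_prop
  have h := hasDerivAt_integral_Iic hcont (hcont.integrable_of_hasCompactSupport hc.mul_left) s
  have he : HasDerivAt (fun s => Real.exp (-κ * s)) (Real.exp (-κ * s) * -κ) s := by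
    simpa using ((hasDerivAt_id s).const_mul (-κ)).exp
  rw [convLeft_eq, show convLeft κ χ = fun s => _ from funext (convLeft_eq κ χ)]
  refine (he.mul h).congr_deriv ?_
  have : Real.exp (-κ * s) * (Real.exp (κ * s) * χ s) = χ s := by
    rw [← mul_assoc, ← Real.exp_add]; simp
  rw [this]; ring

lemma hasDerivAt_convRight (κ : ℝ) {χ : ℝ → ℝ} (hχ : Continuous χ) (hc : HasCompactSupport χ)
    (s : ℝ) : HasDerivAt (convRight κ χ) (κ * convRight κ χ s - χ s) s := by
  have hcont : Continuous fun t => Real.exp (-κ * t) * χ t := by fun_prop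
  have h := hasDerivAt_integral_Ioi hcont (hcont.integrable_of_hasCompactSupport hc.mul_left) s
  have he : HasDerivAt (fun s => Real.exp (κ * s)) (Real.exp (κ * s) * κ) s := by
    simpa using ((hasDerivAt_id s).const_mul κ).exp
  rw [convRight_eq, show convRight κ χ = fun s => _ from funext (convRight_eq κ χ)]
  refine (he.mul h).congr_deriv ?_
  have : Real.exp (κ * s) * (Real.exp (-κ * s) * χ s) = χ s := by
    rw [← mul_assoc, ← Real.exp_add]; simp
  rw [mul_neg, this]; ring

/-- Bootstrapping in a first-order linear equation. It makes the half-convolutions smooth although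
their kernels jump, so that they may occur in test functions. -/
lemma contDiff_of_deriv_eq_linear {u χ : ℝ → ℝ} {c d : ℝ}
    (h : ∀ s, HasDerivAt u (c * u s + d * χ s) s) (hχ : ContDiff ℝ ∞ χ) : ContDiff ℝ ∞ u := by
  rw [contDiff_infty]
  intro m
  induction m with
  | zero =>
    exact contDiff_zero.2 (continuous_iff_continuousAt.2 fun s => (h s).continuousAt)
  | succ m ih =>
    rw [show ((m + 1 : ℕ) : WithTop ℕ∞) = (m : WithTop ℕ∞) + 1 by norm_cast,
      contDiff_succ_iff_deriv]
    refine ⟨fun s => (h s).differentiableAt, by simp, ?_⟩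
    rw [show deriv u = fun s => c * u s + d * χ s from funext fun s => (h s).deriv]
    exact (contDiff_const.mul ih).add (contDiff_const.mul (hχ.of_le (by exact_mod_cast le_top)))

/-- A weak solution `y` of `y'' - κ² y = κ v`, multiplied by a cut-off function `η`, is dominated by
the Green potential of `|η v| + (|η'| + |η''|) |y|`. -/
theorem enorm_cutoff_mul_le_green {κ S : ℝ} (hκ : 1 ≤ κ) {y v η : ℝ → ℝ}
    (hy : Integrable y) (hv : Integrable v) (hη : ContDiff ℝ ∞ η)
    (hηS : tsupport η ⊆ Icc (-S) S)
    (heq : ∀ ψ : ℝ → ℝ, ContDiff ℝ ∞ ψ → tsupport ψ ⊆ Icc (-S) S →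
      ∫ s, (deriv (deriv ψ) s - κ ^ 2 * ψ s) * y s = κ * ∫ s, ψ s * v s) :
    ∀ᵐ t, ‖η t * y t‖ₑ ≤ ∫⁻ s, ENNReal.ofReal (Real.exp (-κ * |t - s|)) *
      (‖η s‖ₑ * ‖v s‖ₑ + (‖deriv η s‖ₑ + ‖deriv (deriv η) s‖ₑ) * ‖y s‖ₑ) := by
  have hκ0 : (0 : ℝ) ≤ κ := by linarith
  have hη1 : ContDiff ℝ ∞ (deriv η) := (contDiff_infty_iff_deriv.1 hη).2
  have hη2 : ContDiff ℝ ∞ (deriv (deriv η)) := (contDiff_infty_iff_deriv.1 hη1).2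
  have hcη : HasCompactSupport η := isCompact_Icc.of_isClosed_subset (isClosed_tsupport _) hηS
  have hcη1 : HasCompactSupport (deriv η) := hcη.deriv
  have hcη2 : HasCompactSupport (deriv (deriv η)) := hcη1.deriv
  obtain ⟨B0, hB0⟩ := hcη.exists_bound_of_continuous hη.continuous
  obtain ⟨B1, hB1⟩ := hcη1.exists_bound_of_continuous hη1.continuous
  obtain ⟨B2, hB2⟩ := hcη2.exists_bound_of_continuous hη2.continuous
  have i1 : Integrable fun s => deriv η s * y s :=
    hy.bdd_mul hη1.continuous.aestronglyMeasurable (Filter.Eventually.of_forall hB1)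
  have i2 : Integrable fun s => deriv (deriv η) s * y s :=
    hy.bdd_mul hη2.continuous.aestronglyMeasurable (Filter.Eventually.of_forall hB2)
  have i0 : Integrable fun s => η s * v s :=
    hv.bdd_mul hη.continuous.aestronglyMeasurable (Filter.Eventually.of_forall hB0)
  have iy : Integrable fun s => η s * y s :=
    hy.bdd_mul hη.continuous.aestronglyMeasurable (Filter.Eventually.of_forall hB0)
  -- With `Ψ` the convolution of `χ` with the kernel, `Ψ' = κ(R - L)` for its right and left halves,
  -- so `2η'Ψ'` contributes `-2κη'` to the density of the left half and `+2κη'` to that of the right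
  -- half.
  set m1 : ℝ → ℝ := fun s =>
    (-2 * κ) * (deriv η s * y s) + deriv (deriv η) s * y s - κ * (η s * v s) with hm1
  set m2 : ℝ → ℝ := fun s =>
    (2 * κ) * (deriv η s * y s) + deriv (deriv η) s * y s - κ * (η s * v s) with hm2
  have im1 : Integrable m1 := ((i1.const_mul _).add i2).sub (i0.const_mul _)
  have im2 : Integrable m2 := ((i1.const_mul _).add i2).sub (i0.const_mul _)
  have kl1 : ∀ s t, |kerLeft κ s t| ≤ 1 := fun s t => by
    rw [abs_of_nonneg (kerLeft_nonneg _ _ _)]; exact kerLeft_le_one hκ0 s t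
  have kr1 : ∀ s t, |kerRight κ s t| ≤ 1 := fun s t => by
    rw [abs_of_nonneg (kerRight_nonneg _ _ _)]; exact kerRight_le_one hκ0 s t
  have key : ∀ᵐ t, 2 * κ * (η t * y t)
      = (∫ s, kerLeft κ s t * m1 s) + ∫ s, kerRight κ s t * m2 s := by
    -- Since `y` is only integrable, the representation is proved by duality: pair with an arbitrary
    -- test function `χ`, use `ηΨ` in the weak equation, and move the kernel off `χ` by Fubini.
    refine ae_eq_of_integral_contDiff_smul_eq (iy.const_mul _).locallyIntegrable
      ((locallyIntegrable_kernel_integral (measurable_kerLeft κ) kl1 im1).add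
        (locallyIntegrable_kernel_integral (measurable_kerRight κ) kr1 im2)) ?_
    intro χ hχ hcχ
    have hχi : Integrable χ := hχ.continuous.integrable_of_hasCompactSupport hcχ
    have dL := hasDerivAt_convLeft κ hχ.continuous hcχ
    have dR := hasDerivAt_convRight κ hχ.continuous hcχ
    have sL : ContDiff ℝ ∞ (convLeft κ χ) :=
      contDiff_of_deriv_eq_linear (c := -κ) (d := 1) (by simpa using dL) hχ
    have sR : ContDiff ℝ ∞ (convRight κ χ) :=
      contDiff_of_deriv_eq_linear (c := κ) (d := -1)
        (by simpa [sub_eq_add_neg] using dR) hχ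
    set Ψ : ℝ → ℝ := fun s => convLeft κ χ s + convRight κ χ s with hΨ
    have sΨ : ContDiff ℝ ∞ Ψ := sL.add sR
    have dΨ : ∀ s, HasDerivAt Ψ (κ * (convRight κ χ s - convLeft κ χ s)) s := fun s => by
      refine ((dL s).add (dR s)).congr_deriv ?_; ring
    -- This is the Green identity `Ψ'' - κ²Ψ = -2κχ`; the last term produces the left side of `key`.
    have ddΨ : ∀ s, HasDerivAt (fun s => κ * (convRight κ χ s - convLeft κ χ s))
        (κ ^ 2 * Ψ s - 2 * κ * χ s) s := fun s => by
      refine (((dR s).sub (dL s)).const_mul κ).congr_deriv ?_; simp only [hΨ]; ring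
    have dη : ∀ s, HasDerivAt η (deriv η s) s := fun s =>
      (hη.differentiable (by simp) s).hasDerivAt
    have ddη : ∀ s, HasDerivAt (deriv η) (deriv (deriv η) s) s := fun s =>
      (hη1.differentiable (by simp) s).hasDerivAt
    have e1 : deriv (fun s => η s * Ψ s)
        = fun s => deriv η s * Ψ s + η s * (κ * (convRight κ χ s - convLeft κ χ s)) :=
      funext fun s => ((dη s).mul (dΨ s)).deriv
    have e2 : ∀ s, deriv (deriv (fun s => η s * Ψ s)) s
        = deriv (deriv η) s * Ψ s + 2 * deriv η s * (κ * (convRight κ χ s - convLeft κ χ s))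
          + η s * (κ ^ 2 * Ψ s - 2 * κ * χ s) := fun s => by
      rw [e1]
      refine (((ddη s).mul (dΨ s)).add ((dη s).mul (ddΨ s))).deriv.trans ?_
      ring
    have h := heq (fun s => η s * Ψ s) (hη.mul sΨ)
      ((closure_mono (Function.support_mul_subset_left η Ψ)).trans hηS)
    simp only [e2] at h
    obtain ⟨B, hB⟩ := hcχ.exists_bound_of_continuous hχ.continuous
    have bdd : ∀ {k : ℝ → ℝ → ℝ}, (∀ s t, |k s t| ≤ 1) → ∀ s, ‖∫ t, k s t * χ t‖ ≤ ∫ t, ‖χ t‖ :=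
      fun hk s => norm_integral_le_of_norm_le hχi.norm (Filter.Eventually.of_forall fun t => by
        rw [norm_mul]; exact mul_le_of_le_one_left (norm_nonneg _) (hk s t))
    have iL : ∀ {w : ℝ → ℝ}, Integrable w → Integrable fun s => convLeft κ χ s * w s := fun hw =>
      hw.bdd_mul sL.continuous.aestronglyMeasurable (Filter.Eventually.of_forall (bdd kl1))
    have iR : ∀ {w : ℝ → ℝ}, Integrable w → Integrable fun s => convRight κ χ s * w s := fun hw =>
      hw.bdd_mul sR.continuous.aestronglyMeasurable (Filter.Eventually.of_forall (bdd kr1))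
    have iχ : Integrable fun s => χ s * (η s * y s) :=
      iy.bdd_mul hχ.continuous.aestronglyMeasurable (Filter.Eventually.of_forall hB)
    have fub1 := integral_kernel_swap (measurable_kerLeft κ) kl1 hχi im1
    have fub2 := integral_kernel_swap (measurable_kerRight κ) kr1 hχi im2
    have locL := (locallyIntegrable_kernel_integral (measurable_kerLeft κ) kl1 im1)
    have locR := (locallyIntegrable_kernel_integral (measurable_kerRight κ) kr1 im2)
    have jL : Integrable fun t => χ t * ∫ s, kerLeft κ s t * m1 s :=
      locL.integrable_smul_left_of_hasCompactSupport hχ.continuous hcχ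
    have jR : Integrable fun t => χ t * ∫ s, kerRight κ s t * m2 s :=
      locR.integrable_smul_left_of_hasCompactSupport hχ.continuous hcχ
    have hsum : ∫ s, (convLeft κ χ s * m1 s + convRight κ χ s * m2 s)
        = ∫ s, 2 * κ * (χ s * (η s * y s)) := by
      have hΨv : Integrable fun s => (η s * Ψ s) * v s := by
        have := (iL i0).add (iR i0)
        refine this.congr (Filter.Eventually.of_forall fun s => ?_)
        simp only [hΨ, Pi.add_apply]; ring
      rw [← integral_const_mul] at h
      have hA : ∀ s, (deriv (deriv η) s * Ψ s
          + 2 * deriv η s * (κ * (convRight κ χ s - convLeft κ χ s))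
          + η s * (κ ^ 2 * Ψ s - 2 * κ * χ s) - κ ^ 2 * (η s * Ψ s)) * y s
          = (convLeft κ χ s * m1 s + convRight κ χ s * m2 s)
            - 2 * κ * (χ s * (η s * y s)) + κ * (η s * Ψ s * v s) := fun s => by
        simp only [hΨ, hm1, hm2]; ring
      simp only [hA] at h
      have iLR : Integrable fun s => convLeft κ χ s * m1 s + convRight κ χ s * m2 s :=
        (iL im1).add (iR im2)
      have iLRχ : Integrable fun s => convLeft κ χ s * m1 s + convRight κ χ s * m2 s
          - 2 * κ * (χ s * (η s * y s)) := iLR.sub (iχ.const_mul _)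
      rw [integral_add iLRχ (hΨv.const_mul _), integral_sub iLR (iχ.const_mul _)] at h
      linarith
    simp only [smul_eq_mul, mul_add]
    rw [integral_add jL jR, ← fub1, ← fub2]
    rw [integral_add (iL im1) (iR im2)] at hsum
    calc ∫ t, χ t * (2 * κ * (η t * y t)) = ∫ s, 2 * κ * (χ s * (η s * y s)) := by
          congr 1; ext s; ring
      _ = _ := hsum.symm
  filter_upwards [key] with t ht
  set w : ℝ → ℝ := fun s => |η s| * |v s| + (|deriv η s| + |deriv (deriv η) s|) * |y s| with hw
  have iw : Integrable w := by
    have := (i0.norm).add (i1.norm.add i2.norm)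
    refine this.congr (Filter.Eventually.of_forall fun s => ?_)
    simp only [hw, Pi.add_apply, norm_mul, Real.norm_eq_abs]; ring
  -- `κ ≥ 1` lets the undifferentiated `η''` term share the factor `2κ`, which then cancels against
  -- the left side and leaves a bound with constant one.
  have hmle : ∀ s, |m1 s| ≤ 2 * κ * w s ∧ |m2 s| ≤ 2 * κ * w s := by
    intro s
    have a1 := abs_mul (deriv η s) (y s)
    have a2 := abs_mul (deriv (deriv η) s) (y s)
    have a3 := abs_mul (η s) (v s)
    have p1 : 0 ≤ |deriv (deriv η) s * y s| := abs_nonneg _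
    have p2 : 0 ≤ |η s * v s| := abs_nonneg _
    have hw' : w s = |η s * v s| + |deriv η s * y s| + |deriv (deriv η) s * y s| := by
      rw [a1, a2, a3]; simp only [hw]; ring
    rw [hw']
    have q1 := le_abs_self (deriv η s * y s)
    have q1' := neg_abs_le (deriv η s * y s)
    have q2 := le_abs_self (deriv (deriv η) s * y s)
    have q2' := neg_abs_le (deriv (deriv η) s * y s)
    have q3 := le_abs_self (η s * v s)
    have q3' := neg_abs_le (η s * v s)
    simp only [hm1, hm2]
    constructor <;> rw [abs_le] <;> constructor <;> nlinarith
  have hker : Integrable fun s => Real.exp (-κ * |t - s|) * w s :=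
    iw.bdd_mul (c := 1) (by fun_prop) (Filter.Eventually.of_forall fun s => by
      rw [Real.norm_eq_abs, Real.abs_exp]; exact exp_neg_mul_abs_le_one hκ0 _)
  have hbd : |η t * y t| ≤ ∫ s, Real.exp (-κ * |t - s|) * w s := by
    have hL : Integrable fun s => kerLeft κ s t * m1 s :=
      im1.bdd_mul (c := 1) ((measurable_kerLeft κ).comp
        (measurable_id.prodMk measurable_const)).aestronglyMeasurable
        (Filter.Eventually.of_forall fun s => kl1 s t)
    have hR : Integrable fun s => kerRight κ s t * m2 s :=
      im2.bdd_mul (c := 1) ((measurable_kerRight κ).comp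
        (measurable_id.prodMk measurable_const)).aestronglyMeasurable
        (Filter.Eventually.of_forall fun s => kr1 s t)
    have : |2 * κ * (η t * y t)| ≤ ∫ s, 2 * κ * (Real.exp (-κ * |t - s|) * w s) := by
      rw [ht, ← integral_add hL hR, ← Real.norm_eq_abs]
      refine norm_integral_le_of_norm_le (hker.const_mul _) (Filter.Eventually.of_forall fun s => ?_)
      rw [← kerLeft_add_kerRight, Real.norm_eq_abs]
      refine (abs_add_le _ _).trans ?_
      rw [abs_mul, abs_mul, abs_of_nonneg (kerLeft_nonneg κ s t),
        abs_of_nonneg (kerRight_nonneg κ s t)]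
      nlinarith [mul_le_mul_of_nonneg_left (hmle s).1 (kerLeft_nonneg κ s t),
        mul_le_mul_of_nonneg_left (hmle s).2 (kerRight_nonneg κ s t)]
    rw [integral_const_mul, abs_mul, abs_of_pos (by linarith : (0:ℝ) < 2 * κ)] at this
    exact le_of_mul_le_mul_left this (by linarith)
  calc ‖η t * y t‖ₑ = ENNReal.ofReal |η t * y t| := by rw [← ofReal_norm]; rfl
    _ ≤ ENNReal.ofReal (∫ s, Real.exp (-κ * |t - s|) * w s) := ENNReal.ofReal_le_ofReal hbd
    _ = ∫⁻ s, ENNReal.ofReal (Real.exp (-κ * |t - s|) * w s) :=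
        ofReal_integral_eq_lintegral_ofReal hker (Filter.Eventually.of_forall fun s => by
          simp only [hw, Pi.zero_apply]; positivity)
    _ = _ := by
        congr 1; ext s
        rw [ENNReal.ofReal_mul (Real.exp_nonneg _)]
        simp only [hw]
        rw [ENNReal.ofReal_add (by positivity) (by positivity), ENNReal.ofReal_mul (abs_nonneg _),
          ENNReal.ofReal_mul (by positivity), ENNReal.ofReal_add (by positivity) (by positivity)]
        simp only [← ofReal_norm, Real.norm_eq_abs]

/-! ### Exponential potentials and Morrey bounds -/

/-- The potential of `g` with respect to the kernel `e^{-κ|t-s|}`. -/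
def expPot (κ : ℝ) (g : ℝ → ℝ≥0∞) (t : ℝ) : ℝ≥0∞ :=
  ∫⁻ s, ENNReal.ofReal (Real.exp (-κ * |t - s|)) * g s

lemma measurable_expPot (κ : ℝ) {g : ℝ → ℝ≥0∞} (hg : Measurable g) : Measurable (expPot κ g) := by
  unfold expPot
  exact Measurable.lintegral_prod_right' (f := fun z : ℝ × ℝ =>
    ENNReal.ofReal (Real.exp (-κ * |z.1 - z.2|)) * g z.2) (by fun_prop)

lemma expPot_mono (κ : ℝ) {g g' : ℝ → ℝ≥0∞} (h : ∀ s, g s ≤ g' s) (t : ℝ) :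
    expPot κ g t ≤ expPot κ g' t :=
  lintegral_mono fun s => mul_le_mul_right (h s) _

/-- The point `s` lies in the window number `⌊|t-s|/h⌋` to the right or left of `t`, and there the
kernel is at most that power of `e^{-κh}`. Integration then reduces the potential to a geometric
series. -/
lemma exp_pot_pointwise {κ h : ℝ} (hκ : 0 ≤ κ) (hh : 0 < h) (g : ℝ → ℝ≥0∞) (t s : ℝ) :
    ENNReal.ofReal (Real.exp (-κ * |t - s|)) * g s ≤
      ∑' j : ℕ, ENNReal.ofReal (Real.exp (-κ * h)) ^ j *
        ((Icc (t + j * h) (t + j * h + h)).indicator g s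
          + (Icc (t - (j + 1) * h) (t - (j + 1) * h + h)).indicator g s) := by
  set j := ⌊|t - s| / h⌋₊
  have h1 : (j : ℝ) * h ≤ |t - s| := by
    rw [← le_div_iff₀ hh]; exact Nat.floor_le (by positivity)
  have h2 : |t - s| ≤ (j + 1) * h := by
    rw [← div_le_iff₀ hh]; exact (Nat.lt_floor_add_one _).le
  refine le_trans ?_ (ENNReal.le_tsum j)
  refine mul_le_mul' ?_ ?_
  · rw [← ENNReal.ofReal_pow (Real.exp_nonneg _), ← Real.exp_nat_mul]
    refine ENNReal.ofReal_le_ofReal (Real.exp_le_exp.2 ?_)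
    nlinarith
  · rcases le_total t s with hts | hts
    · rw [abs_of_nonpos (by linarith)] at h1 h2
      rw [indicator_of_mem (show s ∈ Icc (t + j * h) (t + j * h + h) from
        ⟨by linarith, by linarith⟩)]
      exact le_self_add
    · rw [abs_of_nonneg (by linarith)] at h1 h2
      rw [indicator_of_mem (s := Icc (t - (j + 1) * h) (t - (j + 1) * h + h)) (show s ∈ _ from
        ⟨by linarith, by linarith⟩)]
      exact le_add_self

/-- A potential is controlled by the integrals of its density over intervals of a fixed length. -/
lemma expPot_le {κ h : ℝ} (hκ : 0 ≤ κ) (hh : 0 < h) {g : ℝ → ℝ≥0∞} (hg : Measurable g)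
    {M : ℝ≥0∞} (hM : ∀ c, ∫⁻ s in Icc c (c + h), g s ≤ M) (t : ℝ) :
    expPot κ g t ≤ (1 - ENNReal.ofReal (Real.exp (-κ * h)))⁻¹ * (2 * M) := by
  calc expPot κ g t ≤ ∫⁻ s, ∑' j : ℕ, ENNReal.ofReal (Real.exp (-κ * h)) ^ j *
        ((Icc (t + j * h) (t + j * h + h)).indicator g s
          + (Icc (t - (j + 1) * h) (t - (j + 1) * h + h)).indicator g s) :=
        lintegral_mono fun s => exp_pot_pointwise hκ hh g t s
    _ = ∑' j : ℕ, ENNReal.ofReal (Real.exp (-κ * h)) ^ j *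
        ((∫⁻ s in Icc (t + j * h) (t + j * h + h), g s)
          + ∫⁻ s in Icc (t - (j + 1) * h) (t - (j + 1) * h + h), g s) := by
        have hm : ∀ a b : ℝ, Measurable ((Icc a b).indicator g) := fun a b =>
          hg.indicator measurableSet_Icc
        rw [lintegral_tsum (fun j => by
          exact (((hm _ _).add (hm _ _)).const_mul _).aemeasurable)]
        congr 1; ext j
        rw [lintegral_const_mul _ (by exact (hm _ _).add (hm _ _)), lintegral_add_left (hm _ _),
          lintegral_indicator measurableSet_Icc, lintegral_indicator measurableSet_Icc]
    _ ≤ ∑' j : ℕ, ENNReal.ofReal (Real.exp (-κ * h)) ^ j * (2 * M) :=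
        ENNReal.tsum_le_tsum fun j => mul_le_mul_right (by
          rw [two_mul]; exact add_le_add (hM _) (hM _)) _
    _ = _ := by rw [ENNReal.tsum_mul_right, ENNReal.tsum_geometric]

/-- The integral of a potential over an interval. -/
lemma lintegral_expPot_le {κ h ρ : ℝ} (hκ : 0 ≤ κ) (hh : 0 < h) {g : ℝ → ℝ≥0∞}
    (hg : Measurable g) {M : ℝ≥0∞} (hM : ∀ c, ∫⁻ s in Icc c (c + ρ), g s ≤ M) (c : ℝ) :
    ∫⁻ t in Icc c (c + ρ), expPot κ g t ≤
      (1 - ENNReal.ofReal (Real.exp (-κ * h)))⁻¹ * (2 * ENNReal.ofReal h) * M := by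
  -- Writing the potential as a convolution moves the interval instead of the kernel: every
  -- translate of `g` has mass at most `M` there, so only the mass of the kernel is left.
  have e1 : ∀ t, expPot κ g t = ∫⁻ u, ENNReal.ofReal (Real.exp (-κ * |u|)) * g (t - u) := by
    intro t
    rw [expPot, ← lintegral_sub_left_eq_self _ t]
    simp
  simp only [e1]
  rw [lintegral_lintegral_swap (by
    refine Measurable.aemeasurable ?_
    fun_prop)]
  calc ∫⁻ u, ∫⁻ t in Icc c (c + ρ), ENNReal.ofReal (Real.exp (-κ * |u|)) * g (t - u)
      ≤ ∫⁻ u, ENNReal.ofReal (Real.exp (-κ * |u|)) * M := by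
        refine lintegral_mono fun u => ?_
        rw [lintegral_const_mul _ (by fun_prop)]
        refine mul_le_mul_right ?_ _
        refine le_trans (le_of_eq ?_) (hM (c - u))
        rw [← lintegral_indicator measurableSet_Icc, ← lintegral_indicator measurableSet_Icc,
          ← lintegral_sub_right_eq_self ((Icc (c - u) (c - u + ρ)).indicator g) u]
        congr 1; ext t
        have : t - u ∈ Icc (c - u) (c - u + ρ) ↔ t ∈ Icc c (c + ρ) := by
          simp only [mem_Icc]; constructor <;> rintro ⟨h1, h2⟩ <;> constructor <;> linarith
        by_cases h : t ∈ Icc c (c + ρ)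
        · rw [indicator_of_mem h, indicator_of_mem (this.2 h)]
        · rw [indicator_of_notMem h, indicator_of_notMem (this.not.2 h)]
    _ = expPot κ (fun _ => 1) 0 * M := by
        rw [lintegral_mul_const _ (by fun_prop)]
        simp [expPot]
    _ ≤ _ := by
        gcongr
        refine expPot_le hκ hh measurable_const (fun c => ?_) 0
        simp

/-- The elementary sum behind the potential estimate in Morrey spaces. -/
lemma tsum_min_le {α : ℝ} (h0 : 0 < α) (h1 : α < 1 / 2) {ρ : ℝ} (hρ : 0 < ρ) :
    ∑' k : ℕ, min (ENNReal.ofReal (ρ * ((k : ℝ) + 1) ^ (-2 * α)))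
      (ENNReal.ofReal (ρ ^ α * ((k : ℝ) + 1) ^ (-1 - α))) ≤
      ENNReal.ofReal ((1 / (1 - 2 * α) + 1 / α) * ρ ^ (2 * α)) := by
  set m : ℝ → ℝ≥0∞ := fun x => min (ENNReal.ofReal (ρ * x ^ (-2 * α)))
    (ENNReal.ofReal (ρ ^ α * x ^ (-1 - α))) with hm
  have hanti : ∀ x y : ℝ, 0 < x → x ≤ y → m y ≤ m x := by
    intro x y hx hxy
    refine min_le_min (ENNReal.ofReal_le_ofReal ?_) (ENNReal.ofReal_le_ofReal ?_)
    · exact mul_le_mul_of_nonneg_left (Real.rpow_le_rpow_of_nonpos hx hxy (by linarith)) hρ.le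
    · exact mul_le_mul_of_nonneg_left (Real.rpow_le_rpow_of_nonpos hx hxy (by linarith))
        (by positivity)
  -- `m` is decreasing, so the sum is compared with its integral.
  have hstep : ∑' k : ℕ, m ((k : ℝ) + 1) ≤ ∫⁻ x in Ioi (0 : ℝ), m x := by
    calc ∑' k : ℕ, m ((k : ℝ) + 1)
        ≤ ∑' k : ℕ, ∫⁻ x in Ioc (k : ℝ) (k + 1), m x := by
          refine ENNReal.tsum_le_tsum fun k => ?_
          calc m ((k : ℝ) + 1) = ∫⁻ x in Ioc (k : ℝ) (k + 1), m ((k : ℝ) + 1) := by simp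
            _ ≤ _ := setLIntegral_mono' measurableSet_Ioc fun x hx =>
                hanti _ _ (lt_of_le_of_lt (Nat.cast_nonneg k) hx.1) hx.2
      _ = ∫⁻ x in ⋃ k : ℕ, Ioc (k : ℝ) (k + 1), m x := by
          rw [lintegral_iUnion (fun k => measurableSet_Ioc)]
          intro i j hij
          rw [Function.onFun, Set.disjoint_left]
          rintro x ⟨a1, a2⟩ ⟨b1, b2⟩
          apply hij
          have c1 : (i : ℝ) < j + 1 := by linarith
          have c2 : (j : ℝ) < i + 1 := by linarith
          norm_cast at c1 c2
          omega
      _ ≤ _ := by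
          refine lintegral_mono_set (iUnion_subset fun k x hx => ?_)
          exact lt_of_le_of_lt (Nat.cast_nonneg k) hx.1
  refine hstep.trans ?_
  -- The two competing terms agree at `x = 1/ρ`. The first is integrable below it because `2α < 1`,
  -- the second above it because `α > 0`; each integral is a multiple of `ρ^{2α}`.
  have hρi : (0 : ℝ) < ρ⁻¹ := by positivity
  have hu : Ioi (0 : ℝ) ⊆ Ioc 0 ρ⁻¹ ∪ Ioi ρ⁻¹ := by rw [Ioc_union_Ioi_eq_Ioi hρi.le]
  have hI1 : ∫⁻ x in Ioc 0 ρ⁻¹, m x ≤ ENNReal.ofReal (1 / (1 - 2 * α) * ρ ^ (2 * α)) := by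
    have hint : IntegrableOn (fun x : ℝ => ρ * x ^ (-2 * α)) (Ioc 0 ρ⁻¹) :=
      ((intervalIntegrable_iff_integrableOn_Ioc_of_le hρi.le).1
        (intervalIntegral.intervalIntegrable_rpow' (by linarith))).const_mul ρ
    calc ∫⁻ x in Ioc 0 ρ⁻¹, m x ≤ ∫⁻ x in Ioc 0 ρ⁻¹, ENNReal.ofReal (ρ * x ^ (-2 * α)) :=
          lintegral_mono fun x => min_le_left _ _
      _ = ENNReal.ofReal (∫ x in Ioc 0 ρ⁻¹, ρ * x ^ (-2 * α)) := by
          rw [ofReal_integral_eq_lintegral_ofReal hint]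
          filter_upwards [ae_restrict_mem measurableSet_Ioc] with x hx
          have := hx.1
          simp only [Pi.zero_apply]; positivity
      _ = _ := by
          rw [integral_const_mul, ← intervalIntegral.integral_of_le hρi.le,
            integral_rpow (Or.inl (by linarith)), Real.zero_rpow (by linarith)]
          congr 1
          rw [Real.inv_rpow hρ.le, ← Real.rpow_neg hρ.le]
          have : ρ * ρ ^ (-(-2 * α + 1)) = ρ ^ (2 * α) := by
            nth_rewrite 1 [← Real.rpow_one ρ]
            rw [← Real.rpow_add hρ]; congr 1; ring
          rw [sub_zero, ← mul_div_assoc, this]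
          rw [show -2 * α + 1 = 1 - 2 * α by ring]; ring
  have hI2 : ∫⁻ x in Ioi ρ⁻¹, m x ≤ ENNReal.ofReal (1 / α * ρ ^ (2 * α)) := by
    have hint : IntegrableOn (fun x : ℝ => ρ ^ α * x ^ (-1 - α)) (Ioi ρ⁻¹) :=
      (integrableOn_Ioi_rpow_of_lt (by linarith) hρi).const_mul _
    calc ∫⁻ x in Ioi ρ⁻¹, m x ≤ ∫⁻ x in Ioi ρ⁻¹, ENNReal.ofReal (ρ ^ α * x ^ (-1 - α)) :=
          lintegral_mono fun x => min_le_right _ _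
      _ = ENNReal.ofReal (∫ x in Ioi ρ⁻¹, ρ ^ α * x ^ (-1 - α)) := by
          rw [ofReal_integral_eq_lintegral_ofReal hint]
          filter_upwards [ae_restrict_mem measurableSet_Ioi] with x hx
          have : 0 < x := hρi.trans hx
          simp only [Pi.zero_apply]; positivity
      _ = _ := by
          rw [integral_const_mul, integral_Ioi_rpow_of_lt (by linarith) hρi]
          congr 1
          rw [Real.inv_rpow hρ.le, ← Real.rpow_neg hρ.le,
            show -(-1 - α + 1) = α by ring, show -1 - α + 1 = -α by ring, neg_div_neg_eq,
            ← mul_div_assoc, ← Real.rpow_add hρ, ← two_mul]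
          ring
  calc ∫⁻ x in Ioi (0 : ℝ), m x ≤ ∫⁻ x in Ioc 0 ρ⁻¹ ∪ Ioi ρ⁻¹, m x := lintegral_mono_set hu
    _ ≤ (∫⁻ x in Ioc 0 ρ⁻¹, m x) + ∫⁻ x in Ioi ρ⁻¹, m x := lintegral_union_le _ _ _
    _ ≤ _ := by
        rw [add_mul, ENNReal.ofReal_add]
        · exact add_le_add hI1 hI2
        · have : 0 < 1 - 2 * α := by linarith
          positivity
        · positivity

/-- The constant in `expPot_le` for `κ h = 1/2`. -/
def potConst : ℝ≥0∞ := (1 - ENNReal.ofReal (Real.exp (-(1 / 2))))⁻¹ * 2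

lemma potConst_ne_top : potConst ≠ ⊤ := by
  unfold potConst
  refine ENNReal.mul_ne_top (ENNReal.inv_ne_top.2 (tsub_pos_of_lt ?_).ne') (by simp)
  rw [← ENNReal.ofReal_one, ENNReal.ofReal_lt_ofReal_iff one_pos, Real.exp_lt_one_iff]
  norm_num

/-- Potential estimate in Morrey spaces: the square function of the potentials with kernels
`e^{-k|t-s|/2}` gains a factor `G ρ^α`. -/
theorem tsum_lintegral_expPot_sq_le {α : ℝ} (h0 : 0 < α) (h1 : α < 1 / 2) {g : ℝ → ℝ≥0∞}
    (hg : Measurable g) {G : ℝ≥0∞}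
    (hG : ∀ c ρ : ℝ, 0 < ρ → ρ ≤ 1 → ∫⁻ s in Icc c (c + ρ), g s ≤ G * ENNReal.ofReal (ρ ^ α))
    (c : ℝ) {ρ : ℝ} (hρ : 0 < ρ) (hρ1 : ρ ≤ 1) :
    ∑' k : ℕ, ∫⁻ t in Icc c (c + ρ), expPot (((k : ℝ) + 1) / 2) g t ^ 2 ≤
      potConst ^ 2 * ENNReal.ofReal (1 / (1 - 2 * α) + 1 / α) * G ^ 2
        * ENNReal.ofReal (ρ ^ (2 * α)) := by
  -- Windows of length `1/(k+1)` make `κh = 1/2`, so the geometric series is the same for every `k`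
  -- and the Morrey bound contributes `(k+1)^{-α}`.
  have hsup : ∀ (k : ℕ) t, expPot (((k : ℝ) + 1) / 2) g t
      ≤ potConst * G * ENNReal.ofReal (((k : ℝ) + 1) ^ (-α)) := by
    intro k t
    have hk : (0 : ℝ) < (k : ℝ) + 1 := by positivity
    have := expPot_le (κ := ((k : ℝ) + 1) / 2) (h := ((k : ℝ) + 1)⁻¹) (by positivity)
      (by positivity) hg (fun c => hG c _ (by positivity) (inv_le_one_of_one_le₀ (by linarith))) t
    rw [show -(((k : ℝ) + 1) / 2) * ((k : ℝ) + 1)⁻¹ = -(1 / 2) by field_simp,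
      Real.inv_rpow hk.le, ← Real.rpow_neg hk.le] at this
    refine this.trans (le_of_eq ?_)
    rw [potConst]; ring
  have hint : ∀ k : ℕ, ∫⁻ t in Icc c (c + ρ), expPot (((k : ℝ) + 1) / 2) g t
      ≤ potConst * G * ENNReal.ofReal (((k : ℝ) + 1)⁻¹ * ρ ^ α) := by
    intro k
    have hk : (0 : ℝ) < (k : ℝ) + 1 := by positivity
    have := lintegral_expPot_le (κ := ((k : ℝ) + 1) / 2) (h := ((k : ℝ) + 1)⁻¹) (by positivity)
      (by positivity) hg (fun c => hG c ρ hρ hρ1) c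
    rw [show -(((k : ℝ) + 1) / 2) * ((k : ℝ) + 1)⁻¹ = -(1 / 2) by field_simp] at this
    refine this.trans (le_of_eq ?_)
    rw [potConst, ENNReal.ofReal_mul (by positivity)]; ring
  -- The square is estimated by sup times sup times length, or by sup times integral. The first is
  -- better for `k + 1 < 1/ρ`, the second beyond.
  have hterm : ∀ k : ℕ, ∫⁻ t in Icc c (c + ρ), expPot (((k : ℝ) + 1) / 2) g t ^ 2 ≤
      (potConst * G) ^ 2 * min (ENNReal.ofReal (ρ * ((k : ℝ) + 1) ^ (-2 * α)))
      (ENNReal.ofReal (ρ ^ α * ((k : ℝ) + 1) ^ (-1 - α))) := by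
    intro k
    have hk : (0 : ℝ) < (k : ℝ) + 1 := by positivity
    rcases min_choice (ENNReal.ofReal (ρ * ((k : ℝ) + 1) ^ (-2 * α)))
      (ENNReal.ofReal (ρ ^ α * ((k : ℝ) + 1) ^ (-1 - α))) with h | h <;> rw [h]
    · calc ∫⁻ t in Icc c (c + ρ), expPot (((k : ℝ) + 1) / 2) g t ^ 2
          ≤ ∫⁻ t in Icc c (c + ρ), (potConst * G * ENNReal.ofReal (((k : ℝ) + 1) ^ (-α))) ^ 2 :=
            lintegral_mono fun t => by gcongr; exact hsup k t
        _ = _ := by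
            rw [lintegral_const, Measure.restrict_apply_univ, Real.volume_Icc, mul_pow, mul_assoc,
              ← ENNReal.ofReal_pow (by positivity), ← ENNReal.ofReal_mul (by positivity)]
            congr 2
            rw [← Real.rpow_natCast, ← Real.rpow_mul hk.le, mul_comm]
            congr 2
            · ring
            · push_cast; ring
    · calc ∫⁻ t in Icc c (c + ρ), expPot (((k : ℝ) + 1) / 2) g t ^ 2
          ≤ ∫⁻ t in Icc c (c + ρ), (potConst * G * ENNReal.ofReal (((k : ℝ) + 1) ^ (-α)))
              * expPot (((k : ℝ) + 1) / 2) g t :=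
            lintegral_mono fun t => by
              rw [sq]; gcongr; exact hsup k t
        _ ≤ (potConst * G * ENNReal.ofReal (((k : ℝ) + 1) ^ (-α))) *
            (potConst * G * ENNReal.ofReal (((k : ℝ) + 1)⁻¹ * ρ ^ α)) := by
            rw [lintegral_const_mul _ (measurable_expPot _ hg)]
            gcongr
            exact hint k
        _ = _ := by
            rw [mul_mul_mul_comm, ← sq, ← ENNReal.ofReal_mul (by positivity)]
            congr 2
            rw [← Real.rpow_neg_one, ← mul_assoc, ← Real.rpow_add hk, mul_comm]
            congr 2; ring
  calc ∑' k : ℕ, ∫⁻ t in Icc c (c + ρ), expPot (((k : ℝ) + 1) / 2) g t ^ 2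
      ≤ ∑' k : ℕ, (potConst * G) ^ 2 * min (ENNReal.ofReal (ρ * ((k : ℝ) + 1) ^ (-2 * α)))
        (ENNReal.ofReal (ρ ^ α * ((k : ℝ) + 1) ^ (-1 - α))) := ENNReal.tsum_le_tsum hterm
    _ ≤ (potConst * G) ^ 2 * ENNReal.ofReal ((1 / (1 - 2 * α) + 1 / α) * ρ ^ (2 * α)) := by
        rw [ENNReal.tsum_mul_left]
        gcongr
        exact tsum_min_le h0 h1 hρ
    _ = _ := by
        have : 0 < 1 - 2 * α := by linarith
        rw [ENNReal.ofReal_mul (by positivity)]; ring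

lemma lintegral_sqrt_mul_sqrt_le {X : Type*} [MeasurableSpace X] (μ : Measure X) {u v : X → ℝ≥0∞}
    (hu : AEMeasurable u μ) (hv : AEMeasurable v μ) :
    ∫⁻ x, u x ^ (1 / 2 : ℝ) * v x ^ (1 / 2 : ℝ) ∂μ ≤
      (∫⁻ x, u x ∂μ) ^ (1 / 2 : ℝ) * (∫⁻ x, v x ∂μ) ^ (1 / 2 : ℝ) := by
  have h := ENNReal.lintegral_mul_le_Lp_mul_Lq μ (Real.HolderConjugate.two_two)
    (hu.pow_const (1 / 2 : ℝ)) (hv.pow_const (1 / 2 : ℝ))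
  have e : ∀ x : ℝ≥0∞, (x ^ (1 / 2 : ℝ)) ^ (2 : ℝ) = x := fun x => by
    rw [← ENNReal.rpow_mul]; norm_num
  simpa only [e, Pi.mul_apply] using h

lemma ENNReal_sqrt_sq (x : ℝ≥0∞) : (x ^ 2) ^ (1 / 2 : ℝ) = x := by
  rw [← ENNReal.rpow_natCast, ← ENNReal.rpow_mul]; norm_num

lemma ENNReal_sq_sqrt (x : ℝ≥0∞) : (x ^ (1 / 2 : ℝ)) ^ 2 = x := by
  rw [← ENNReal.rpow_natCast, ← ENNReal.rpow_mul]; norm_num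

lemma ENNReal_add_sq_le (x y : ℝ≥0∞) : (x + y) ^ 2 ≤ 2 * x ^ 2 + 2 * y ^ 2 := by
  have h := ENNReal.rpow_add_le_mul_rpow_add_rpow x y (p := 2) (by norm_num)
  norm_num at h
  calc (x + y) ^ 2 ≤ 2 * (x ^ 2 + y ^ 2) := h
    _ = _ := mul_add _ _ _

/-! ### Weighted estimates and the absorption argument -/

/-- The weight `e^{-|s-τ|/2}`. -/
def expWeight (τ s : ℝ) : ℝ≥0∞ := ENNReal.ofReal (Real.exp (-(1 / 2) * |s - τ|))

lemma measurable_expWeight (τ : ℝ) : Measurable (expWeight τ) := by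
  unfold expWeight; fun_prop

lemma expWeight_le_one (τ s : ℝ) : expWeight τ s ≤ 1 := by
  rw [expWeight, ← ENNReal.ofReal_one]
  exact ENNReal.ofReal_le_ofReal (exp_neg_mul_abs_le_one (by norm_num) _)

/-- By the triangle inequality, moving the weight from `t` to `s` costs at most `e^{|t-s|/2}`. As `κ
≥ 1`, half of the kernel pays for it. -/
lemma expWeight_mul_expPot_le (τ : ℝ) {κ : ℝ} (hκ : 1 ≤ κ) {g : ℝ → ℝ≥0∞} (t : ℝ) :
    expWeight τ t * expPot κ g t ≤ expPot (κ / 2) (fun s => expWeight τ s * g s) t := by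
  unfold expPot
  rw [← lintegral_const_mul' _ _ (by simp [expWeight])]
  refine lintegral_mono fun s => ?_
  rw [← mul_assoc, ← mul_assoc]
  gcongr ?_ * _
  rw [expWeight, expWeight, ← ENNReal.ofReal_mul (Real.exp_nonneg _),
    ← ENNReal.ofReal_mul (Real.exp_nonneg _), ← Real.exp_add, ← Real.exp_add]
  refine ENNReal.ofReal_le_ofReal (Real.exp_le_exp.2 ?_)
  have h : |s - τ| ≤ |t - s| + |t - τ| := by
    calc |s - τ| = |(t - τ) - (t - s)| := by ring_nf
      _ ≤ |t - τ| + |t - s| := abs_sub _ _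
      _ = _ := add_comm _ _
  nlinarith [abs_nonneg (t - s)]

/-- The constant of the Morrey estimate. -/
def morreyConst (α : ℝ) : ℝ≥0∞ := potConst ^ 2 * ENNReal.ofReal (1 / (1 - 2 * α) + 1 / α)

lemma morreyConst_ne_top (α : ℝ) : morreyConst α ≠ ⊤ :=
  ENNReal.mul_ne_top (ENNReal.pow_ne_top potConst_ne_top) ENNReal.ofReal_ne_top

/-- A pointwise bound by potentials of `g` gives a weighted Morrey bound from one for `g`. -/
lemma weighted_morrey_le {α : ℝ} (h0 : 0 < α) (h1 : α < 1 / 2) {c₀ : ℝ≥0∞} (hc₀ : c₀ ≠ ⊤)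
    {F g : ℝ → ℝ≥0∞} (hg : Measurable g) (τ : ℝ)
    (hrep : ∀ᵐ t, F t ≤ c₀ * ∑' k : ℕ, expPot ((k : ℝ) + 1) g t ^ 2) {G : ℝ≥0∞}
    (hG : ∀ c ρ : ℝ, 0 < ρ → ρ ≤ 1 →
      ∫⁻ s in Icc c (c + ρ), expWeight τ s * g s ≤ G * ENNReal.ofReal (ρ ^ α))
    (c : ℝ) {ρ : ℝ} (hρ : 0 < ρ) (hρ1 : ρ ≤ 1) :
    ∫⁻ t in Icc c (c + ρ), expWeight τ t ^ 2 * F t ≤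
      c₀ * morreyConst α * G ^ 2 * ENNReal.ofReal (ρ ^ (2 * α)) := by
  have hgω : Measurable fun s => expWeight τ s * g s := (measurable_expWeight τ).mul hg
  calc ∫⁻ t in Icc c (c + ρ), expWeight τ t ^ 2 * F t
      ≤ ∫⁻ t in Icc c (c + ρ), c₀ * ∑' k : ℕ,
          expPot (((k : ℝ) + 1) / 2) (fun s => expWeight τ s * g s) t ^ 2 := by
        refine lintegral_mono_ae (ae_restrict_of_ae ?_)
        filter_upwards [hrep] with t ht
        calc expWeight τ t ^ 2 * F t
            ≤ expWeight τ t ^ 2 * (c₀ * ∑' k : ℕ, expPot ((k : ℝ) + 1) g t ^ 2) := by gcongr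
          _ = c₀ * ∑' k : ℕ, (expWeight τ t * expPot ((k : ℝ) + 1) g t) ^ 2 := by
              simp only [mul_pow]
              rw [ENNReal.tsum_mul_left]; ring
          _ ≤ _ := by
              refine mul_le_mul_right (ENNReal.tsum_le_tsum fun k => ?_) _
              gcongr
              exact expWeight_mul_expPot_le τ (by simp) t
    _ = c₀ * ∑' k : ℕ, ∫⁻ t in Icc c (c + ρ),
          expPot (((k : ℝ) + 1) / 2) (fun s => expWeight τ s * g s) t ^ 2 := by
        rw [lintegral_const_mul' _ _ hc₀, lintegral_tsum]
        exact fun k => ((measurable_expPot _ hgω).pow_const 2).aemeasurable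
    _ ≤ c₀ * (morreyConst α * G ^ 2 * ENNReal.ofReal (ρ ^ (2 * α))) := by
        refine mul_le_mul_right ?_ _
        exact tsum_lintegral_expPot_sq_le h0 h1 hgω hG c hρ hρ1
    _ = _ := by ring

/-- Exponential decay from a potential bound whose density is critical with a small coefficient. -/
theorem exp_decay_of_potential_bound {α : ℝ} (h0 : 0 < α) (h1 : α < 1 / 2) {c₀ K : ℝ≥0∞}
    (hc₀ : c₀ ≠ ⊤) {a b l e d : ℝ → ℝ≥0∞} (ha : Measurable a) (hb : Measurable b)
    (hl : Measurable l) (he : Measurable e) (hd : Measurable d) {S : ℝ} {E δ : ℝ≥0∞}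
    (hK : K ≠ ⊤) (hE : E ≠ ⊤)
    (hrep : ∀ᵐ t, e t ^ 2 * a t ≤ c₀ * ∑' k : ℕ, expPot ((k : ℝ) + 1) (fun s =>
      e s * (b s ^ (1 / 2 : ℝ) * a s ^ (1 / 2 : ℝ)) + d s * a s ^ (1 / 2 : ℝ)) t ^ 2)
    (hrep' : ∀ᵐ t, e t ^ 2 * a t ≤ c₀ * ∑' k : ℕ, expPot ((k : ℝ) + 1) (fun s =>
      e s * l s + d s * a s ^ (1 / 2 : ℝ)) t ^ 2)
    {G' : ℝ≥0∞} (hG' : G' ≠ ⊤) (hlG : ∀ c ρ : ℝ, 0 < ρ → ρ ≤ 1 →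
      ∫⁻ s in Icc c (c + ρ), e s * l s ≤ G' * ENNReal.ofReal (ρ ^ α))
    (hdK : ∀ s, d s ≤ K) (hdS : ∀ s, |s| < S → d s = 0)
    (hbδ : ∀ c, ∫⁻ s in Icc c (c + 1), b s ≤ δ) (haE : ∫⁻ s, a s ≤ E)
    (hsmall : c₀ * morreyConst α * (2 * δ) ≤ 1 / 2) (τ : ℝ) :
    ∫⁻ s in Icc τ (τ + 1), e s ^ 2 * a s ≤ ENNReal.ofReal (Real.exp 1) *
      (4 * c₀ * morreyConst α * K ^ 2) * E * ENNReal.ofReal (Real.exp (-(S - |τ|))) := by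
  have hαρ : ∀ {ρ : ℝ}, 0 < ρ → ρ ≤ 1 → ENNReal.ofReal ρ ^ (1 / 2 : ℝ) ≤ ENNReal.ofReal (ρ ^ α) := by
    intro ρ hρ hρ1
    rw [ENNReal.ofReal_rpow_of_pos hρ]
    exact ENNReal.ofReal_le_ofReal (Real.rpow_le_rpow_of_exponent_ge hρ hρ1 h1.le)
  set D : ℝ≥0∞ := ENNReal.ofReal (Real.exp (-(1 / 2) * (S - |τ|))) with hD
  have hω := measurable_expWeight τ
  -- `d` lives only where `|s| ≥ S`, at distance at least `S - |τ|` from `τ`. This is the sole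
  -- source of decay; `D` is squared at the end, which doubles the exponent to one.
  have hωd : ∀ s, expWeight τ s * d s ≤ D * K := by
    intro s
    rcases lt_or_ge |s| S with h | h
    · rw [hdS s h, mul_zero]; exact zero_le
    · refine mul_le_mul' (ENNReal.ofReal_le_ofReal (Real.exp_le_exp.2 ?_)) (hdK s)
      have : |s| ≤ |s - τ| + |τ| := by simpa using abs_add_le (s - τ) τ
      linarith
  have hbdry : ∀ c ρ : ℝ, 0 < ρ → ρ ≤ 1 →
      ∫⁻ s in Icc c (c + ρ), expWeight τ s * (d s * a s ^ (1 / 2 : ℝ))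
        ≤ D * K * E ^ (1 / 2 : ℝ) * ENNReal.ofReal (ρ ^ α) := by
    intro c ρ hρ hρ1
    calc ∫⁻ s in Icc c (c + ρ), expWeight τ s * (d s * a s ^ (1 / 2 : ℝ))
        ≤ ∫⁻ s in Icc c (c + ρ), D * K * ((fun _ => 1 : ℝ → ℝ≥0∞) s ^ (1 / 2 : ℝ)
            * a s ^ (1 / 2 : ℝ)) := by
          refine lintegral_mono fun s => ?_
          simp only [ENNReal.one_rpow, one_mul]
          rw [← mul_assoc]; exact mul_le_mul_left (hωd s) _
      _ = D * K * ∫⁻ s in Icc c (c + ρ), ((fun _ => 1 : ℝ → ℝ≥0∞) s ^ (1 / 2 : ℝ)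
            * a s ^ (1 / 2 : ℝ)) :=
          lintegral_const_mul' _ _ (ENNReal.mul_ne_top ENNReal.ofReal_ne_top hK)
      _ ≤ D * K * (ENNReal.ofReal ρ ^ (1 / 2 : ℝ) * E ^ (1 / 2 : ℝ)) := by
          gcongr
          refine (lintegral_sqrt_mul_sqrt_le _ aemeasurable_const ha.aemeasurable).trans ?_
          gcongr
          · simp
          · exact (setLIntegral_le_lintegral _ _).trans haE
      _ ≤ D * K * (ENNReal.ofReal (ρ ^ α) * E ^ (1 / 2 : ℝ)) := by
          gcongr; exact hαρ hρ hρ1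
      _ = _ := by ring
  set F : ℝ → ℝ≥0∞ := fun s => expWeight τ s ^ 2 * (e s ^ 2 * a s) with hF
  have hFm : Measurable F := (hω.pow_const 2).mul ((he.pow_const 2).mul ha)
  -- The Morrey norm, with exponent `2α`, of the weighted and cut-off energy density; this is the
  -- quantity to be absorbed.
  set N : ℝ≥0∞ := ⨆ (c : ℝ) (ρ : ℝ) (_ : 0 < ρ) (_ : ρ ≤ 1),
    (∫⁻ s in Icc c (c + ρ), F s) / ENNReal.ofReal (ρ ^ (2 * α)) with hN
  have hpos : ∀ {ρ : ℝ}, 0 < ρ → ENNReal.ofReal (ρ ^ (2 * α)) ≠ 0 := fun hρ => by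
    simpa using Real.rpow_pos_of_pos hρ _
  have hNle : ∀ c ρ : ℝ, 0 < ρ → ρ ≤ 1 →
      ∫⁻ s in Icc c (c + ρ), F s ≤ N * ENNReal.ofReal (ρ ^ (2 * α)) := by
    intro c ρ hρ hρ1
    rw [← ENNReal.div_le_iff (hpos hρ) ENNReal.ofReal_ne_top]
    exact le_iSup₂_of_le c ρ (le_iSup₂_of_le hρ hρ1 le_rfl)
  have hleN : ∀ M : ℝ≥0∞, (∀ c ρ : ℝ, 0 < ρ → ρ ≤ 1 →
      ∫⁻ s in Icc c (c + ρ), F s ≤ M * ENNReal.ofReal (ρ ^ (2 * α))) → N ≤ M := by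
    intro M hM
    refine iSup₂_le fun c ρ => iSup₂_le fun hρ hρ1 => ?_
    rw [ENNReal.div_le_iff (hpos hρ) ENNReal.ofReal_ne_top]
    exact hM c ρ hρ hρ1
  have hCtop : c₀ * morreyConst α ≠ ⊤ := ENNReal.mul_ne_top hc₀ (morreyConst_ne_top α)
  have hGd : D * K * E ^ (1 / 2 : ℝ) ≠ ⊤ :=
    ENNReal.mul_ne_top (ENNReal.mul_ne_top ENNReal.ofReal_ne_top hK)
      (ENNReal.rpow_ne_top_of_nonneg (by norm_num) hE)
  -- This is applied twice: with `u = l` for qualitative finiteness of `N`, then with `u = b^{1/2}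
  -- a^{1/2}` for the quantitative bound.
  have hsplit : ∀ (u : ℝ → ℝ≥0∞) (_ : Measurable u) (H : ℝ≥0∞),
      (∀ c ρ : ℝ, 0 < ρ → ρ ≤ 1 →
        ∫⁻ s in Icc c (c + ρ), expWeight τ s * (e s * u s) ≤ H * ENNReal.ofReal (ρ ^ α)) →
      (∀ᵐ t, e t ^ 2 * a t ≤ c₀ * ∑' k : ℕ, expPot ((k : ℝ) + 1) (fun s =>
        e s * u s + d s * a s ^ (1 / 2 : ℝ)) t ^ 2) →
      N ≤ c₀ * morreyConst α * (H + D * K * E ^ (1 / 2 : ℝ)) ^ 2 := by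
    intro u hu H hH hr
    refine hleN _ fun c ρ hρ hρ1 => ?_
    refine weighted_morrey_le h0 h1 hc₀ (g := fun s => e s * u s + d s * a s ^ (1 / 2 : ℝ))
      ((he.mul hu).add (hd.mul (ha.pow_const _))) τ hr ?_ c hρ hρ1
    intro c ρ hρ hρ1
    simp only [mul_add]
    rw [lintegral_add_left (by exact hω.mul (he.mul hu)), add_mul]
    exact add_le_add (hH c ρ hρ hρ1) (hbdry c ρ hρ hρ1)
  have hNtop : N ≠ ⊤ := by
    refine ne_top_of_le_ne_top ?_ (hsplit l hl G' (fun c ρ hρ hρ1 => ?_) hrep')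
    · exact ENNReal.mul_ne_top hCtop (ENNReal.pow_ne_top (ENNReal.add_ne_top.2 ⟨hG', hGd⟩))
    · refine le_trans (lintegral_mono fun s => ?_) (hlG c ρ hρ hρ1)
      exact mul_le_of_le_one_left zero_le (expWeight_le_one τ s)
  have hNabs : N ≤ c₀ * morreyConst α *
      (δ ^ (1 / 2 : ℝ) * N ^ (1 / 2 : ℝ) + D * K * E ^ (1 / 2 : ℝ)) ^ 2 := by
    refine hsplit _ ((hb.pow_const _).mul (ha.pow_const _)) _ (fun c ρ hρ hρ1 => ?_) hrep
    calc ∫⁻ s in Icc c (c + ρ), expWeight τ s * (e s * (b s ^ (1 / 2 : ℝ) * a s ^ (1 / 2 : ℝ)))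
        = ∫⁻ s in Icc c (c + ρ), b s ^ (1 / 2 : ℝ) * F s ^ (1 / 2 : ℝ) := by
          congr 1; ext s
          simp only [hF]
          rw [ENNReal.mul_rpow_of_nonneg _ _ (by norm_num),
            ENNReal.mul_rpow_of_nonneg _ _ (by norm_num), ENNReal_sqrt_sq, ENNReal_sqrt_sq]
          ring
      _ ≤ (∫⁻ s in Icc c (c + ρ), b s) ^ (1 / 2 : ℝ)
            * (∫⁻ s in Icc c (c + ρ), F s) ^ (1 / 2 : ℝ) :=
          lintegral_sqrt_mul_sqrt_le _ hb.aemeasurable hFm.aemeasurable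
      _ ≤ δ ^ (1 / 2 : ℝ) * (N * ENNReal.ofReal (ρ ^ (2 * α))) ^ (1 / 2 : ℝ) := by
          gcongr
          · exact (lintegral_mono_set (Icc_subset_Icc_right (by linarith))).trans (hbδ c)
          · exact hNle c ρ hρ hρ1
      _ = _ := by
          rw [ENNReal.mul_rpow_of_nonneg _ _ (by norm_num),
            ENNReal.ofReal_rpow_of_nonneg (by positivity) (by norm_num), ← Real.rpow_mul hρ.le,
            show 2 * α * (1 / 2) = α by ring, mul_assoc]
  have hfin : N ≤ 4 * c₀ * morreyConst α * K ^ 2 * E * ENNReal.ofReal (Real.exp (-(S - |τ|))) := by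
    have hDsq : D ^ 2 = ENNReal.ofReal (Real.exp (-(S - |τ|))) := by
      rw [hD, ← ENNReal.ofReal_pow (Real.exp_nonneg _), ← Real.exp_nat_mul]
      congr 2; push_cast; ring
    set Y := c₀ * morreyConst α * (2 * (D * K * E ^ (1 / 2 : ℝ)) ^ 2) with hY
    -- The factor two in `hsmall` comes from `(x + y)² ≤ 2x² + 2y²`. The term `N/2` can be
    -- subtracted since `N` is already known to be finite.
    have h3 : N ≤ 1 / 2 * N + Y := by
      calc N ≤ c₀ * morreyConst α * (2 * (δ ^ (1 / 2 : ℝ) * N ^ (1 / 2 : ℝ)) ^ 2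
            + 2 * (D * K * E ^ (1 / 2 : ℝ)) ^ 2) :=
            hNabs.trans (by gcongr; exact ENNReal_add_sq_le _ _)
        _ = c₀ * morreyConst α * (2 * δ) * N + Y := by
            rw [mul_pow, ENNReal_sq_sqrt, ENNReal_sq_sqrt, hY]; ring
        _ ≤ _ := by gcongr
    have h4 : N ≤ 2 * Y := by
      have hhalf : N = 1 / 2 * N + 1 / 2 * N := by
        rw [← add_mul, ENNReal.add_halves, one_mul]
      have hne : 1 / 2 * N ≠ ⊤ := ENNReal.mul_ne_top (by simp) hNtop
      have : 1 / 2 * N ≤ Y := by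
        rw [hhalf] at h3
        rw [← ENNReal.add_le_add_iff_left hne]
        calc _ ≤ _ := h3
          _ = _ := by rw [← hhalf]
      calc N = 2 * (1 / 2 * N) := by
            rw [← mul_assoc, ENNReal.mul_div_cancel (by simp) (by simp), one_mul]
        _ ≤ _ := by gcongr
    refine h4.trans (le_of_eq ?_)
    rw [hY, mul_pow, mul_pow, hDsq, ENNReal_sq_sqrt]; ring
  calc ∫⁻ s in Icc τ (τ + 1), e s ^ 2 * a s
      ≤ ∫⁻ s in Icc τ (τ + 1), ENNReal.ofReal (Real.exp 1) * F s := by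
        refine setLIntegral_mono' measurableSet_Icc fun s hs => ?_
        -- On `[τ, τ + 1]` the squared weight is at least `e^{-1}`, and `N` with `ρ = 1` controls
        -- this interval.
        have : 1 ≤ ENNReal.ofReal (Real.exp 1) * expWeight τ s ^ 2 := by
          rw [expWeight, ← ENNReal.ofReal_pow (Real.exp_nonneg _), ← Real.exp_nat_mul,
            ← ENNReal.ofReal_mul (Real.exp_nonneg _), ← Real.exp_add, ENNReal.one_le_ofReal]
          refine Real.one_le_exp ?_
          have h1 : |s - τ| ≤ 1 := by
            rw [abs_of_nonneg (by linarith [hs.1])]; linarith [hs.2]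
          push_cast; linarith
        calc e s ^ 2 * a s = 1 * (e s ^ 2 * a s) := (one_mul _).symm
          _ ≤ ENNReal.ofReal (Real.exp 1) * expWeight τ s ^ 2 * (e s ^ 2 * a s) := by gcongr
          _ = _ := by simp only [hF]; ring
    _ = ENNReal.ofReal (Real.exp 1) * ∫⁻ s in Icc τ (τ + 1), F s := lintegral_const_mul _ hFm
    _ ≤ ENNReal.ofReal (Real.exp 1) * N := by
        gcongr; simpa using hNle τ 1 one_pos le_rfl
    _ ≤ ENNReal.ofReal (Real.exp 1) *
        (4 * c₀ * morreyConst α * K ^ 2 * E * ENNReal.ofReal (Real.exp (-(S - |τ|)))) := by gcongr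
    _ = _ := by ring

/-! ### Fourier modes on the circle -/

/-- The function `cos (k θ)` on the circle. -/
def cosMode (k : ℤ) (θ : AddCircle (2 * Real.pi)) : ℝ := (fourier k θ).re

/-- The function `sin (k θ)` on the circle. -/
def sinMode (k : ℤ) (θ : AddCircle (2 * Real.pi)) : ℝ := (fourier k θ).im

lemma fourier_two_pi_coe (k : ℤ) (x : ℝ) :
    fourier k (x : AddCircle (2 * Real.pi)) = Complex.exp ((k * x : ℝ) * Complex.I) := by
  rw [fourier_coe_apply]
  congr 1
  have : (Real.pi : ℂ) ≠ 0 := by exact_mod_cast Real.pi_ne_zero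
  push_cast
  field_simp

lemma cosMode_coe (k : ℤ) (x : ℝ) : cosMode k (x : AddCircle (2 * Real.pi)) = Real.cos (k * x) := by
  rw [cosMode, fourier_two_pi_coe, Complex.exp_ofReal_mul_I_re]

lemma sinMode_coe (k : ℤ) (x : ℝ) : sinMode k (x : AddCircle (2 * Real.pi)) = Real.sin (k * x) := by
  rw [sinMode, fourier_two_pi_coe, Complex.exp_ofReal_mul_I_im]

lemma continuous_cosMode (k : ℤ) : Continuous (cosMode k) :=
  Complex.continuous_re.comp (fourier k).continuous

lemma continuous_sinMode (k : ℤ) : Continuous (sinMode k) :=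
  Complex.continuous_im.comp (fourier k).continuous

lemma abs_cosMode_le (k : ℤ) (θ) : |cosMode k θ| ≤ 1 := by
  induction θ using QuotientAddGroup.induction_on with
  | H x => exact (congrArg abs (cosMode_coe k x)).trans_le (Real.abs_cos_le_one _)

lemma abs_sinMode_le (k : ℤ) (θ) : |sinMode k θ| ≤ 1 := by
  induction θ using QuotientAddGroup.induction_on with
  | H x => exact (congrArg abs (sinMode_coe k x)).trans_le (Real.abs_sin_le_one _)

/-- Parseval's inequality on the circle, in terms of cosine and sine coefficients. -/
lemma lintegral_sq_le_tsum_modes {g : AddCircle (2 * Real.pi) → ℝ} (hg : MemLp g 2) :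
    ∫⁻ θ, ‖g θ‖ₑ ^ 2 ≤ ∑' k : ℤ, (‖∫ θ, cosMode k θ * g θ‖ₑ ^ 2 + ‖∫ θ, sinMode k θ * g θ‖ₑ ^ 2) := by
  have hpi := Real.two_pi_pos
  have hgi : Integrable g := hg.integrable (by norm_num)
  have hC : MemLp (fun θ => (g θ : ℂ)) 2 := hg.ofReal
  have hH : MemLp (fun θ => (g θ : ℂ)) 2 (AddCircle.haarAddCircle (T := 2 * Real.pi)) :=
    hC.haarAddCircle
  have hs := hasSum_sq_fourierCoeff hH.toLp
  have hcoef : ∀ k : ℤ, ‖fourierCoeff (hH.toLp : AddCircle (2 * Real.pi) → ℂ) k‖ ^ 2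
      = ((2 * Real.pi)⁻¹) ^ 2 * ((∫ θ, cosMode k θ * g θ) ^ 2 + (∫ θ, sinMode k θ * g θ) ^ 2) := by
    intro k
    rw [fourierCoeff_congr_ae hH.coeFn_toLp, fourierCoeff, AddCircle.integral_haarAddCircle,
      norm_smul, mul_pow, Real.norm_of_nonneg (by positivity)]
    congr 1
    have hfi : Integrable fun θ => fourier (-k) θ • (g θ : ℂ) :=
      hgi.ofReal.bdd_mul (c := 1) (fourier (-k)).continuous.aestronglyMeasurable
        (Filter.Eventually.of_forall fun θ => by
          rw [fourier_apply]; exact (Circle.norm_coe _).le)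
    have hre : (∫ θ, fourier (-k) θ • (g θ : ℂ)).re = ∫ θ, cosMode k θ * g θ := by
      refine (integral_re hfi).symm.trans ?_
      congr 1; ext θ
      simp [cosMode]
    have him : (∫ θ, fourier (-k) θ • (g θ : ℂ)).im = - ∫ θ, sinMode k θ * g θ := by
      refine (integral_im hfi).symm.trans ?_
      rw [← integral_neg]
      congr 1; ext θ
      simp [sinMode]
    rw [← Complex.normSq_eq_norm_sq, Complex.normSq_apply, hre, him]
    ring
  have hint : ∫ θ, ‖(hH.toLp : AddCircle (2 * Real.pi) → ℂ) θ‖ ^ 2 ∂AddCircle.haarAddCircle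
      = (2 * Real.pi)⁻¹ * ∫ θ, g θ ^ 2 := by
    rw [integral_congr_ae (g := fun θ => g θ ^ 2)]
    · rw [AddCircle.integral_haarAddCircle, smul_eq_mul]
    · filter_upwards [hH.coeFn_toLp] with θ hθ
      rw [hθ]; simp
  simp only [hcoef] at hs
  rw [hint] at hs
  have hs' := hs.mul_left (2 * Real.pi)
  rw [← mul_assoc, mul_inv_cancel₀ hpi.ne', one_mul] at hs'
  have hsq : Integrable fun θ => g θ ^ 2 := hg.integrable_sq
  calc ∫⁻ θ, ‖g θ‖ₑ ^ 2 = ENNReal.ofReal (∫ θ, g θ ^ 2) := by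
        rw [ofReal_integral_eq_lintegral_ofReal hsq (Filter.Eventually.of_forall fun θ => sq_nonneg _)]
        congr 1; ext θ
        rw [← ofReal_norm, ← ENNReal.ofReal_pow (norm_nonneg _), Real.norm_eq_abs, sq_abs]
    _ = ∑' k : ℤ, ENNReal.ofReal (2 * Real.pi * (((2 * Real.pi)⁻¹) ^ 2 *
          ((∫ θ, cosMode k θ * g θ) ^ 2 + (∫ θ, sinMode k θ * g θ) ^ 2))) := by
        rw [← ENNReal.ofReal_tsum_of_nonneg (fun k => by positivity) hs'.summable, hs'.tsum_eq]
    _ ≤ _ := by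
        refine ENNReal.tsum_le_tsum fun k => ?_
        have e : ∀ x : ℝ, ‖x‖ₑ ^ 2 = ENNReal.ofReal (x ^ 2) := fun x => by
          rw [← ofReal_norm, ← ENNReal.ofReal_pow (norm_nonneg _), Real.norm_eq_abs, sq_abs]
        rw [e, e, ← ENNReal.ofReal_add (sq_nonneg _) (sq_nonneg _)]
        refine ENNReal.ofReal_le_ofReal ?_
        -- The measure has mass `2π` whereas Fourier coefficients use the normalised one; the
        -- resulting factor `1/(2π)` is discarded.
        have h1 : 2 * Real.pi * ((2 * Real.pi)⁻¹) ^ 2 ≤ 1 := by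
          rw [sq, ← mul_assoc, mul_inv_cancel₀ hpi.ne', one_mul]
          exact inv_le_one_of_one_le₀ (by linarith [Real.pi_gt_three])
        rw [← mul_assoc]
        exact mul_le_of_le_one_left (by positivity) h1

/-- Folds the sum over integer frequencies to one over `|k| = 1, 2, …`. The vanishing zero mode
matters: its kernel would not decay. -/
lemma tsum_int_le_two_mul {u : ℤ → ℝ≥0∞} {w : ℕ → ℝ≥0∞} (h0 : u 0 = 0)
    (hp : ∀ k : ℕ, u (k + 1) ≤ w k) (hn : ∀ k : ℕ, u (-(k + 1)) ≤ w k) :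
    ∑' k : ℤ, u k ≤ 2 * ∑' k : ℕ, w k := by
  have e1 : ∑' k : ℤ, u k = (∑' k : ℕ, u k) + ∑' k : ℕ, u (-(k + 1)) :=
    tsum_of_nat_of_neg_add_one ENNReal.summable ENNReal.summable
  have e2 : ∑' k : ℕ, u k = ∑' k : ℕ, u (k + 1) := by
    have := tsum_eq_zero_add' (f := fun k : ℕ => u k) ENNReal.summable
    simpa [h0] using this
  rw [e1, e2, two_mul]
  exact add_le_add (ENNReal.tsum_le_tsum hp) (ENNReal.tsum_le_tsum hn)

/-! ### Mode equations and the potential bound for the circle energy -/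

/-- The Fourier modes of `D` on `S¹ × [-S, S]` solve `y'' - k² y = k v` weakly, where `v` is the
conjugate mode of `L`, and the mean of `D` over circles vanishes: this is the weak form of
`D = ∂_θ f`, `L = Δf`. -/
structure ModeEq (S : ℝ) (D L : Cyl → ℝ) : Prop where
  sin_eq : ∀ (k : ℤ) (ψ : ℝ → ℝ), ContDiff ℝ ∞ ψ → tsupport ψ ⊆ Icc (-S) S →
    ∫ x : Cyl, ((deriv (deriv ψ) x.2 - (k : ℝ) ^ 2 * ψ x.2) * sinMode k x.1) * D x =
      -(k : ℝ) * ∫ x : Cyl, (ψ x.2 * cosMode k x.1) * L x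
  cos_eq : ∀ (k : ℤ) (ψ : ℝ → ℝ), ContDiff ℝ ∞ ψ → tsupport ψ ⊆ Icc (-S) S →
    ∫ x : Cyl, ((deriv (deriv ψ) x.2 - (k : ℝ) ^ 2 * ψ x.2) * cosMode k x.1) * D x =
      (k : ℝ) * ∫ x : Cyl, (ψ x.2 * sinMode k x.1) * L x
  mean : ∀ ψ : ℝ → ℝ, ContDiff ℝ ∞ ψ → tsupport ψ ⊆ Icc (-S) S → ∫ x : Cyl, ψ x.2 * D x = 0

/-- The coefficient of `D` with respect to `q` on the circle at height `t`. -/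
def slice (q : AddCircle (2 * Real.pi) → ℝ) (D : Cyl → ℝ) (t : ℝ) : ℝ := ∫ θ, q θ * D (θ, t)

section slice

variable {q : AddCircle (2 * Real.pi) → ℝ} {D : Cyl → ℝ}

lemma integrable_mul_fst (hq : Continuous q) (hq1 : ∀ θ, |q θ| ≤ 1) (hD : Integrable D) :
    Integrable fun x : Cyl => q x.1 * D x :=
  hD.bdd_mul (c := 1) (hq.comp continuous_fst).aestronglyMeasurable
    (Filter.Eventually.of_forall fun x => hq1 x.1)

lemma integrable_slice (hq : Continuous q) (hq1 : ∀ θ, |q θ| ≤ 1) (hD : Integrable D) :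
    Integrable (slice q D) :=
  (integrable_mul_fst hq hq1 hD).integral_prod_right

lemma integral_mul_slice (hq : Continuous q) (hq1 : ∀ θ, |q θ| ≤ 1) (hD : Integrable D)
    {w : ℝ → ℝ} (hw : Continuous w) {B : ℝ} (hB : ∀ t, |w t| ≤ B) :
    ∫ x : Cyl, (w x.2 * q x.1) * D x = ∫ t, w t * slice q D t := by
  have hi : Integrable (fun x : Cyl => (w x.2 * q x.1) * D x) (volume.prod volume) := by
    have := (integrable_mul_fst hq hq1 hD).bdd_mul (c := B)
      (hw.comp continuous_snd).aestronglyMeasurable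
      (Filter.Eventually.of_forall fun x => hB x.2)
    refine this.congr (Filter.Eventually.of_forall fun x => ?_)
    simp only [Function.comp_apply]; ring
  rw [Measure.volume_eq_prod, integral_prod_symm _ hi]
  congr 1; ext t
  rw [slice, ← integral_const_mul]
  congr 1; ext θ
  ring

lemma enorm_slice_le (hq1 : ∀ θ, |q θ| ≤ 1) (t : ℝ) :
    ‖slice q D t‖ₑ ≤ ∫⁻ θ, ‖D (θ, t)‖ₑ := by
  refine (enorm_integral_le_lintegral_enorm _).trans (lintegral_mono fun θ => ?_)
  rw [enorm_mul]
  refine mul_le_of_le_one_left zero_le ?_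
  rw [← ofReal_norm, ← ENNReal.ofReal_one]
  exact ENNReal.ofReal_le_ofReal (hq1 θ)

end slice

/-- The Green potential bound for one pair of conjugate modes. -/
lemma enorm_slice_le_expPot {k : ℤ} (hk : k ≠ 0) {S σ : ℝ} (hσ : |σ| = |(k : ℝ)|)
    {q r : AddCircle (2 * Real.pi) → ℝ}
    (hq : Continuous q) (hq1 : ∀ θ, |q θ| ≤ 1) (hr : Continuous r) (hr1 : ∀ θ, |r θ| ≤ 1)
    {D L : Cyl → ℝ} (hD : Integrable D) (hL : Integrable L)
    (heq : ∀ ψ : ℝ → ℝ, ContDiff ℝ ∞ ψ → tsupport ψ ⊆ Icc (-S) S →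
      ∫ x : Cyl, ((deriv (deriv ψ) x.2 - (k : ℝ) ^ 2 * ψ x.2) * q x.1) * D x =
        σ * ∫ x : Cyl, (ψ x.2 * r x.1) * L x)
    {η : ℝ → ℝ} (hη : ContDiff ℝ ∞ η) (hηS : tsupport η ⊆ Icc (-S) S) :
    ∀ᵐ t, ‖η t * slice q D t‖ₑ ≤ expPot |(k : ℝ)| (fun s => ‖η s‖ₑ * (∫⁻ θ, ‖L (θ, s)‖ₑ) +
      (‖deriv η s‖ₑ + ‖deriv (deriv η) s‖ₑ) * ∫⁻ θ, ‖D (θ, s)‖ₑ) t := by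
  have hκ : 1 ≤ |(k : ℝ)| := by
    rw [← Int.cast_abs]; exact_mod_cast Int.one_le_abs hk
  have hκ0 : |(k : ℝ)| ≠ 0 := by positivity
  -- The Green estimate takes `κ = |k|`, so the sign of `σ` is moved into the source term, where the
  -- norm removes it.
  have hG := enorm_cutoff_mul_le_green (κ := |(k : ℝ)|) (S := S) hκ
    (y := slice q D) (v := fun t => (σ / |(k : ℝ)|) * slice r L t) (η := η)
    (integrable_slice hq hq1 hD) ((integrable_slice hr hr1 hL).const_mul _) hη hηS ?_
  · filter_upwards [hG] with t ht
    refine ht.trans (expPot_mono _ (fun s => ?_) t)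
    have e : ‖σ / |(k : ℝ)| * slice r L s‖ₑ = ‖slice r L s‖ₑ := by
      rw [enorm_mul, ← ofReal_norm, Real.norm_eq_abs, abs_div, hσ, abs_abs, div_self hκ0]
      simp
    rw [e]
    gcongr
    · exact enorm_slice_le hr1 s
    · exact enorm_slice_le hq1 s
  · intro ψ hψ hψS
    have hψ1 : ContDiff ℝ ∞ (deriv ψ) := (contDiff_infty_iff_deriv.1 hψ).2
    have hψ2 : ContDiff ℝ ∞ (deriv (deriv ψ)) := (contDiff_infty_iff_deriv.1 hψ1).2
    have hc : HasCompactSupport ψ := isCompact_Icc.of_isClosed_subset (isClosed_tsupport _) hψS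
    obtain ⟨B0, hB0⟩ := hc.exists_bound_of_continuous hψ.continuous
    obtain ⟨B2, hB2⟩ := hc.deriv.deriv.exists_bound_of_continuous hψ2.continuous
    have h := heq ψ hψ hψS
    have hcont : Continuous fun t => deriv (deriv ψ) t - (k : ℝ) ^ 2 * ψ t :=
      hψ2.continuous.sub (continuous_const.mul hψ.continuous)
    rw [integral_mul_slice hq hq1 hD (w := fun t => deriv (deriv ψ) t - (k : ℝ) ^ 2 * ψ t)
      hcont (B := B2 + (k : ℝ) ^ 2 * B0), integral_mul_slice hr hr1 hL hψ.continuous hB0] at h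
    · rw [sq_abs, h, ← integral_const_mul, ← integral_const_mul]
      congr 1; ext s
      field_simp
    · intro t
      refine (abs_sub _ _).trans (add_le_add (hB2 t) ?_)
      rw [abs_mul, abs_of_nonneg (sq_nonneg _)]
      exact mul_le_mul_of_nonneg_left (hB0 t) (sq_nonneg _)

lemma ModeEq.enorm_slice_le {S : ℝ} {D L : Cyl → ℝ} (h : ModeEq S D L) (hD : Integrable D)
    (hL : Integrable L) {η : ℝ → ℝ} (hη : ContDiff ℝ ∞ η) (hηS : tsupport η ⊆ Icc (-S) S)
    {k : ℤ} (hk : k ≠ 0) :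
    ∀ᵐ t, ‖η t * slice (cosMode k) D t‖ₑ ^ 2 + ‖η t * slice (sinMode k) D t‖ₑ ^ 2 ≤
      2 * expPot |(k : ℝ)| (fun s => ‖η s‖ₑ * (∫⁻ θ, ‖L (θ, s)‖ₑ) +
        (‖deriv η s‖ₑ + ‖deriv (deriv η) s‖ₑ) * ∫⁻ θ, ‖D (θ, s)‖ₑ) t ^ 2 := by
  filter_upwards [enorm_slice_le_expPot hk (σ := k) rfl (continuous_cosMode k) (abs_cosMode_le k)
      (continuous_sinMode k) (abs_sinMode_le k) hD hL (h.cos_eq k) hη hηS,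
    enorm_slice_le_expPot hk (σ := -k) (abs_neg _) (continuous_sinMode k) (abs_sinMode_le k)
      (continuous_cosMode k) (abs_cosMode_le k) hD hL (h.sin_eq k) hη hηS] with t h1 h2
  rw [two_mul]
  gcongr

/-- For `k = 0` the mode equation only says that `y` is affine where it holds. That the mean
vanishes is separate information, coming from `D` being a `θ`-derivative. -/
lemma ModeEq.mean_eq_zero {S : ℝ} {D L : Cyl → ℝ} (h : ModeEq S D L) (hD : Integrable D)
    {η : ℝ → ℝ} (hη : ContDiff ℝ ∞ η) (hηS : tsupport η ⊆ Icc (-S) S) :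
    ∀ᵐ t, η t * slice (cosMode 0) D t = 0 := by
  have hi := integrable_slice (continuous_cosMode 0) (abs_cosMode_le 0) hD
  have hc : HasCompactSupport η := isCompact_Icc.of_isClosed_subset (isClosed_tsupport _) hηS
  obtain ⟨B, hB⟩ := hc.exists_bound_of_continuous hη.continuous
  refine ae_eq_zero_of_integral_contDiff_smul_eq_zero
    (hi.bdd_mul hη.continuous.aestronglyMeasurable
      (Filter.Eventually.of_forall hB)).locallyIntegrable fun χ hχ hcχ => ?_
  obtain ⟨B', hB'⟩ := hcχ.exists_bound_of_continuous hχ.continuous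
  have hsm : ContDiff ℝ ∞ fun t => χ t * η t := hχ.mul hη
  have := h.mean (fun t => χ t * η t) hsm
    ((closure_mono (Function.support_mul_subset_right χ η)).trans hηS)
  have h2 := integral_mul_slice (continuous_cosMode 0) (abs_cosMode_le 0) hD hsm.continuous
    (B := B' * B) (fun t => by
      rw [abs_mul]
      exact mul_le_mul (hB' t) (hB t) (abs_nonneg _) ((norm_nonneg _).trans (hB' t)))
  simp only [smul_eq_mul, ← mul_assoc]
  rw [← h2, ← this]
  congr 1; ext x
  simp [cosMode]

lemma slice_sinMode_zero (D : Cyl → ℝ) (t : ℝ) : slice (sinMode 0) D t = 0 := by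
  simp [slice, sinMode]

variable {n : ℕ}

lemma enorm_sq_eq_sum (v : EuclideanSpace ℝ (Fin n)) : ‖v‖ₑ ^ 2 = ∑ j, ‖v j‖ₑ ^ 2 := by
  simp only [← ofReal_norm, ← ENNReal.ofReal_pow (norm_nonneg _)]
  rw [EuclideanSpace.norm_sq_eq, ENNReal.ofReal_sum_of_nonneg fun j _ => sq_nonneg _]

lemma enorm_apply_le (v : EuclideanSpace ℝ (Fin n)) (j : Fin n) : ‖v j‖ₑ ≤ ‖v‖ₑ := by
  simp only [← ofReal_norm]
  exact ENNReal.ofReal_le_ofReal (PiLp.norm_apply_le v j)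

lemma lintegral_circle_le_sqrt {g : AddCircle (2 * Real.pi) → ℝ≥0∞} (hg : Measurable g) :
    ∫⁻ θ, g θ ≤ ENNReal.ofReal (2 * Real.pi) ^ (1 / 2 : ℝ) * (∫⁻ θ, g θ ^ 2) ^ (1 / 2 : ℝ) := by
  have h := lintegral_sqrt_mul_sqrt_le (volume : Measure (AddCircle (2 * Real.pi)))
    (u := fun _ => 1) (v := fun θ => g θ ^ 2) aemeasurable_const (hg.pow_const 2).aemeasurable
  simp only [ENNReal_sqrt_sq, ENNReal.one_rpow, one_mul, lintegral_const,
    AddCircle.measure_univ] at h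
  exact h

/-- The circle energy of `D`, cut off by `η`, is bounded by a square function of potentials. -/
theorem circle_energy_le_expPot {S : ℝ} {D L : Cyl → EuclideanSpace ℝ (Fin n)}
    (hDm : StronglyMeasurable D) (hDi : Integrable D) (hLi : Integrable L)
    (hD2 : ∫⁻ x, ‖D x‖ₑ ^ 2 ≠ ⊤)
    (hmode : ∀ j, ModeEq S (fun x => D x j) (fun x => L x j))
    {η : ℝ → ℝ} (hη : ContDiff ℝ ∞ η) (hηS : tsupport η ⊆ Icc (-S) S) :
    ∀ᵐ t, ‖η t‖ₑ ^ 2 * (∫⁻ θ, ‖D (θ, t)‖ₑ ^ 2) ≤ (4 * n : ℝ≥0∞) * ∑' k : ℕ, expPot ((k : ℝ) + 1)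
      (fun s => ‖η s‖ₑ * (∫⁻ θ, ‖L (θ, s)‖ₑ) +
        (ENNReal.ofReal (2 * Real.pi) ^ (1 / 2 : ℝ) * (‖deriv η s‖ₑ + ‖deriv (deriv η) s‖ₑ)) *
          (∫⁻ θ, ‖D (θ, s)‖ₑ ^ 2) ^ (1 / 2 : ℝ)) t ^ 2 := by
  have hDj : ∀ j, Integrable fun x => D x j := fun j =>
    (EuclideanSpace.proj (𝕜 := ℝ) j : EuclideanSpace ℝ (Fin n) →L[ℝ] ℝ).integrable_comp hDi
  have hLj : ∀ j, Integrable fun x => L x j := fun j =>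
    (EuclideanSpace.proj (𝕜 := ℝ) j : EuclideanSpace ℝ (Fin n) →L[ℝ] ℝ).integrable_comp hLi
  have hDjm : ∀ j, Measurable fun x => D x j := fun j =>
    (EuclideanSpace.proj (𝕜 := ℝ) j : EuclideanSpace ℝ (Fin n) →L[ℝ] ℝ).continuous.measurable.comp
      hDm.measurable
  have hsl : ∀ t : ℝ, Measurable fun θ : AddCircle (2 * Real.pi) => ((θ, t) : Cyl) := fun t =>
    measurable_id.prodMk measurable_const
  have hfin : ∀ᵐ t, ∫⁻ θ, ‖D (θ, t)‖ₑ ^ 2 < ⊤ := by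
    rw [Measure.volume_eq_prod, lintegral_prod_symm _
      (hDm.measurable.enorm.pow_const 2).aemeasurable] at hD2
    exact ae_lt_top (Measurable.lintegral_prod_left' (hDm.measurable.enorm.pow_const 2)) hD2
  have hmodes := ae_all_iff.2 fun j => ae_all_iff.2 fun k : ℤ => ae_all_iff.2 fun hk : k ≠ 0 =>
    (hmode j).enorm_slice_le (hDj j) (hLj j) hη hηS hk
  have hmean := ae_all_iff.2 fun j => (hmode j).mean_eq_zero (hDj j) hη hηS
  filter_upwards [hfin, hmodes, hmean] with t ht hm h0
  set P : ℕ → ℝ≥0∞ := fun k => expPot ((k : ℝ) + 1)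
      (fun s => ‖η s‖ₑ * (∫⁻ θ, ‖L (θ, s)‖ₑ) +
        (ENNReal.ofReal (2 * Real.pi) ^ (1 / 2 : ℝ) * (‖deriv η s‖ₑ + ‖deriv (deriv η) s‖ₑ)) *
          (∫⁻ θ, ‖D (θ, s)‖ₑ ^ 2) ^ (1 / 2 : ℝ)) t with hP
  have hbound : ∀ j (k : ℤ) (m : ℕ), |(k : ℝ)| = (m : ℝ) + 1 →
      ‖η t * slice (cosMode k) (fun x => D x j) t‖ₑ ^ 2
        + ‖η t * slice (sinMode k) (fun x => D x j) t‖ₑ ^ 2 ≤ 2 * P m ^ 2 := by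
    intro j k m hkm
    have hk : k ≠ 0 := by
      rintro rfl
      simp only [Int.cast_zero, abs_zero] at hkm
      have : (0 : ℝ) ≤ m := Nat.cast_nonneg m
      linarith
    refine (hm j k hk).trans ?_
    rw [hkm]
    gcongr
    refine expPot_mono _ (fun s => ?_) t
    refine add_le_add ?_ ?_
    · gcongr; exact enorm_apply_le _ _
    · rw [mul_comm (ENNReal.ofReal (2 * Real.pi) ^ (1 / 2 : ℝ)), mul_assoc]
      gcongr
      calc ∫⁻ θ, ‖D (θ, s) j‖ₑ ≤ ∫⁻ θ, ‖D (θ, s)‖ₑ := lintegral_mono fun θ => enorm_apply_le _ _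
        _ ≤ _ := lintegral_circle_le_sqrt ((hDm.measurable.comp (hsl s)).enorm)
  have hj : ∀ j, ‖η t‖ₑ ^ 2 * ∫⁻ θ, ‖D (θ, t) j‖ₑ ^ 2 ≤ 4 * ∑' k, P k ^ 2 := by
    intro j
    have hmem : MemLp (fun θ => D (θ, t) j) 2 := by
      refine ⟨((hDjm j).comp (hsl t)).aestronglyMeasurable, ?_⟩
      rw [eLpNorm_lt_top_iff_lintegral_rpow_enorm_lt_top (by norm_num) (by norm_num)]
      refine lt_of_le_of_lt (lintegral_mono fun θ => ?_) ht
      norm_num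
      gcongr
      exact enorm_apply_le _ _
    calc ‖η t‖ₑ ^ 2 * ∫⁻ θ, ‖D (θ, t) j‖ₑ ^ 2
        ≤ ‖η t‖ₑ ^ 2 * ∑' k : ℤ, (‖slice (cosMode k) (fun x => D x j) t‖ₑ ^ 2
            + ‖slice (sinMode k) (fun x => D x j) t‖ₑ ^ 2) := by
          gcongr; exact lintegral_sq_le_tsum_modes hmem
      _ = ∑' k : ℤ, (‖η t * slice (cosMode k) (fun x => D x j) t‖ₑ ^ 2
            + ‖η t * slice (sinMode k) (fun x => D x j) t‖ₑ ^ 2) := by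
          rw [← ENNReal.tsum_mul_left]
          congr 1; ext k
          rw [enorm_mul, enorm_mul]; ring
      -- One factor two counts `±k`, the other the sine and cosine modes; summing over the `n`
      -- components gives `4n`.
      _ ≤ 2 * ∑' k : ℕ, 2 * P k ^ 2 := by
          refine tsum_int_le_two_mul ?_ (fun k => hbound j _ k ?_) (fun k => hbound j _ k ?_)
          · simp [h0 j, slice_sinMode_zero]
          · push_cast; exact abs_of_pos (by positivity)
          · push_cast; rw [abs_neg]; exact abs_of_pos (by positivity)
      _ = _ := by rw [ENNReal.tsum_mul_left, ← mul_assoc]; norm_num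
  calc ‖η t‖ₑ ^ 2 * (∫⁻ θ, ‖D (θ, t)‖ₑ ^ 2)
      = ∑ j, ‖η t‖ₑ ^ 2 * ∫⁻ θ, ‖D (θ, t) j‖ₑ ^ 2 := by
        simp only [enorm_sq_eq_sum]
        rw [lintegral_finsetSum _ fun j _ => by
          exact (((hDjm j).comp (hsl t)).enorm.pow_const 2), Finset.mul_sum]
    _ ≤ ∑ _j : Fin n, 4 * ∑' k, P k ^ 2 := Finset.sum_le_sum fun j _ => hj j
    _ = _ := by
        rw [Finset.sum_const, Finset.card_univ, Fintype.card_fin, nsmul_eq_mul]; ring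

/-! ### Weak derivatives tested against products -/

lemma continuous_shift (i : Fin 2) : Continuous (shift i) := by
  unfold shift
  split_ifs
  · exact (AddCircle.continuous_mk' _).prodMk continuous_const
  · exact continuous_const.prodMk continuous_id

lemma shift_zero (i : Fin 2) : shift i 0 = 0 := by
  unfold shift; split_ifs <;> simp

/-- The coordinate vector in the direction `i`. -/
def coordVec (i : Fin 2) : ℝ × ℝ := if i = 0 then (1, 0) else (0, 1)

lemma partialDeriv_coe {φ : Cyl → ℝ} {i : Fin 2}
    (hφ : ContDiff ℝ ∞ (fun y : ℝ × ℝ => φ ((y.1 : AddCircle (2 * Real.pi)), y.2))) (y : ℝ × ℝ) :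
    partialDeriv i φ ((y.1 : AddCircle (2 * Real.pi)), y.2) =
      fderiv ℝ (fun y : ℝ × ℝ => φ ((y.1 : AddCircle (2 * Real.pi)), y.2)) y (coordVec i) := by
  set F : ℝ × ℝ → ℝ := fun y => φ ((y.1 : AddCircle (2 * Real.pi)), y.2) with hF
  have e : (fun s : ℝ => φ (((y.1 : AddCircle (2 * Real.pi)), y.2) + shift i s))
      = fun s : ℝ => F (y + s • coordVec i) := by
    ext s
    fin_cases i <;> simp [shift, coordVec, hF]
  rw [partialDeriv, e]
  have h1 : HasFDerivAt F (fderiv ℝ F y) (y + (0 : ℝ) • coordVec i) := by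
    simpa using (hφ.differentiable (by simp) y).hasFDerivAt
  have h2 : HasDerivAt (fun s : ℝ => y + s • coordVec i) (coordVec i) 0 := by
    simpa using ((hasDerivAt_id (0 : ℝ)).smul_const (coordVec i)).const_add y
  exact (h1.comp_hasDerivAt (0 : ℝ) h2).deriv

lemma partialDeriv_eq_zero {φ : Cyl → ℝ} {i : Fin 2} {x : Cyl} (hx : x ∉ tsupport φ) :
    partialDeriv i φ x = 0 := by
  have h1 : φ =ᶠ[nhds x] 0 := notMem_tsupport_iff_eventuallyEq.1 hx
  have h2 : Filter.Tendsto (fun s : ℝ => x + shift i s) (nhds 0) (nhds x) := by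
    have : Continuous fun s : ℝ => x + shift i s := continuous_const.add (continuous_shift i)
    simpa [shift_zero] using this.tendsto 0
  have h3 : (fun s : ℝ => φ (x + shift i s)) =ᶠ[nhds 0] fun _ => 0 := h2.eventually h1
  rw [partialDeriv, h3.deriv_eq, deriv_const]

/-- Needed to integrate by parts twice, so that second weak derivatives can be compared through the
function itself. -/
lemma IsTest.partialDeriv {U : Set Cyl} {φ : Cyl → ℝ} (h : IsTest U φ) (i : Fin 2) :
    IsTest U (partialDeriv i φ) := by
  have hsub : tsupport (WillmoreCyl.partialDeriv i φ) ⊆ tsupport φ := by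
    refine closure_minimal (fun x hx => ?_) (isClosed_tsupport _)
    by_contra hx'
    exact hx (partialDeriv_eq_zero hx')
  refine ⟨?_, h.compact.of_isClosed_subset (isClosed_tsupport _) hsub, hsub.trans h.subset⟩
  simp only [partialDeriv_coe h.smooth]
  exact (h.smooth.fderiv_right (m := ∞) (by simp)).clm_apply contDiff_const

/-- Weak derivatives of two weak derivatives of the same function agree. -/
lemma IsWeakPartial.of_isWeakPartial {U : Set Cyl} {i : Fin 2}
    {f g g' l : Cyl → EuclideanSpace ℝ (Fin n)} (hg : IsWeakPartial U i f g)
    (hg' : IsWeakPartial U i f g') (hl : IsWeakPartial U i g l) : IsWeakPartial U i g' l := by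
  refine ⟨hg'.locInt_deriv, hl.locInt_deriv, fun φ hφ => ?_⟩
  rw [← hl.byParts φ hφ]
  have h1 := hg.byParts _ (hφ.partialDeriv i)
  have h2 := hg'.byParts _ (hφ.partialDeriv i)
  rw [h1] at h2
  exact (neg_injective h2).symm

lemma isWeakPartial_weakPartial {U : Set Cyl} {i : Fin 2} {f g : Cyl → EuclideanSpace ℝ (Fin n)}
    (h : IsWeakPartial U i f g) : IsWeakPartial U i f (weakPartial U i f) := by
  have hex : ∃ g, IsWeakPartial U i f g := ⟨g, h⟩
  rw [weakPartial, dif_pos hex]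
  exact hex.choose_spec

section product

variable {q q' : AddCircle (2 * Real.pi) → ℝ} {ψ : ℝ → ℝ}

lemma partialDeriv_zero_prod (hq : ∀ y : ℝ, HasDerivAt (fun s : ℝ => q s) (q' y) y) (x : Cyl) :
    partialDeriv 0 (fun x : Cyl => ψ x.2 * q x.1) x = ψ x.2 * q' x.1 := by
  obtain ⟨θ, t⟩ := x
  induction θ using QuotientAddGroup.induction_on with
  | H y =>
    have h : HasDerivAt (fun s : ℝ => q ((y + s : ℝ) : AddCircle (2 * Real.pi))) (q' y) 0 := by
      have := HasDerivAt.comp_const_add (f := fun s : ℝ => q s) y 0 (by simpa using hq y)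
      exact this
    have e : (fun s : ℝ => (fun x : Cyl => ψ x.2 * q x.1)
        (((y : AddCircle (2 * Real.pi)), t) + shift 0 s))
        = fun s : ℝ => ψ t * q ((y + s : ℝ) : AddCircle (2 * Real.pi)) := by
      ext s; simp [shift]
    exact (congrArg (fun u => deriv u 0) e).trans (h.const_mul _).deriv

lemma partialDeriv_one_prod (hψ : ContDiff ℝ ∞ ψ) (x : Cyl) :
    partialDeriv 1 (fun x : Cyl => ψ x.2 * q x.1) x = deriv ψ x.2 * q x.1 := by
  have h : HasDerivAt (fun s : ℝ => ψ (x.2 + s)) (deriv ψ x.2) 0 := by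
    refine HasDerivAt.comp_const_add (f := ψ) x.2 0 ?_
    simpa using (hψ.differentiable (by simp) x.2).hasDerivAt
  have e : (fun s : ℝ => (fun x : Cyl => ψ x.2 * q x.1) (x + shift 1 s))
      = fun s : ℝ => ψ (x.2 + s) * q x.1 := by
    ext s; simp [shift]
  rw [partialDeriv, e]
  exact (h.mul_const _).deriv

lemma tsupport_prod_subset {S : ℝ} (hψS : tsupport ψ ⊆ Icc (-S) S) :
    tsupport (fun x : Cyl => ψ x.2 * q x.1) ⊆ Q S := by
  refine closure_minimal (fun x hx => ?_) (isClosed_univ.prod isClosed_Icc)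
  refine ⟨mem_univ _, hψS (subset_tsupport _ ?_)⟩
  exact left_ne_zero_of_mul hx

lemma isCompact_Q (S : ℝ) : IsCompact (Q S) := isCompact_univ.prod isCompact_Icc

lemma Q_subset_Qo {S T : ℝ} (h : S < T) : Q S ⊆ Qo T :=
  prod_mono subset_rfl fun x hx => ⟨by linarith [hx.1], by linarith [hx.2]⟩

lemma isTest_prod {S T : ℝ} (hST : S < T) (hψ : ContDiff ℝ ∞ ψ) (hψS : tsupport ψ ⊆ Icc (-S) S)
    (hq : ContDiff ℝ ∞ fun s : ℝ => q s) : IsTest (Qo T) (fun x : Cyl => ψ x.2 * q x.1) where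
  smooth := (hψ.comp contDiff_snd).mul (hq.comp contDiff_fst)
  compact := (isCompact_Q S).of_isClosed_subset (isClosed_tsupport _) (tsupport_prod_subset hψS)
  subset := (tsupport_prod_subset hψS).trans (Q_subset_Qo hST)

/-- `g` is controlled only on `Q S`, which suffices because `ψ` vanishes off `[-S, S]`. -/
lemma integrable_prod_smul {S : ℝ} (hψ : Continuous ψ) (hψS : tsupport ψ ⊆ Icc (-S) S)
    (hq : Continuous q) (hq1 : ∀ θ, |q θ| ≤ 1) {g : Cyl → EuclideanSpace ℝ (Fin n)}
    (hg : IntegrableOn g (Q S)) : Integrable fun x : Cyl => (ψ x.2 * q x.1) • g x := by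
  have hc : HasCompactSupport ψ := isCompact_Icc.of_isClosed_subset (isClosed_tsupport _) hψS
  obtain ⟨B, hB⟩ := hc.exists_bound_of_continuous hψ
  have hm : MeasurableSet (Q S) := (isCompact_Q S).measurableSet
  have h := (hg.integrable_indicator hm).bdd_smul (φ := fun x : Cyl => ψ x.2 * q x.1) B
    (by fun_prop) (Filter.Eventually.of_forall fun x => by
      rw [norm_mul]
      calc ‖ψ x.2‖ * ‖q x.1‖ ≤ B * 1 := mul_le_mul (hB _) (hq1 _) (norm_nonneg _)
            ((norm_nonneg _).trans (hB 0))
        _ = B := mul_one _)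
  refine h.congr (Filter.Eventually.of_forall fun x => ?_)
  by_cases hx : x ∈ Q S
  · simp [indicator_of_mem hx]
  · have : ψ x.2 = 0 := by
      by_contra h0
      exact hx ⟨mem_univ _, hψS (subset_tsupport _ h0)⟩
    simp [this]

end product

lemma hasDerivAt_cosMode (k : ℤ) (y : ℝ) :
    HasDerivAt (fun s : ℝ => cosMode k s) (-(k : ℝ) * sinMode k y) y := by
  simp only [cosMode_coe, sinMode_coe]
  have := ((hasDerivAt_id y).const_mul (k : ℝ)).cos
  refine this.congr_deriv ?_
  simp; ring

lemma hasDerivAt_sinMode (k : ℤ) (y : ℝ) :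
    HasDerivAt (fun s : ℝ => sinMode k s) ((k : ℝ) * cosMode k y) y := by
  simp only [cosMode_coe, sinMode_coe]
  have := ((hasDerivAt_id y).const_mul (k : ℝ)).sin
  refine this.congr_deriv ?_
  simp; ring

lemma contDiff_cosMode (k : ℤ) : ContDiff ℝ ∞ (fun s : ℝ => cosMode k s) := by
  simp only [cosMode_coe]; fun_prop

lemma contDiff_sinMode (k : ℤ) : ContDiff ℝ ∞ (fun s : ℝ => sinMode k s) := by
  simp only [sinMode_coe]; fun_prop

section weak

variable {S T : ℝ} {f D0 D1 L0 L1 : Cyl → EuclideanSpace ℝ (Fin n)} {ψ : ℝ → ℝ}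

lemma IsWeakPartial.prod_zero (h0 : IsWeakPartial (Qo T) 0 f D0) (hST : S < T)
    (hψ : ContDiff ℝ ∞ ψ) (hψS : tsupport ψ ⊆ Icc (-S) S)
    {q q' : AddCircle (2 * Real.pi) → ℝ} (hq : ContDiff ℝ ∞ fun s : ℝ => q s)
    (hq' : ∀ y : ℝ, HasDerivAt (fun s : ℝ => q s) (q' y) y) :
    ∫ x : Cyl, (ψ x.2 * q' x.1) • f x = - ∫ x : Cyl, (ψ x.2 * q x.1) • D0 x := by
  rw [← h0.byParts _ (isTest_prod hST hψ hψS hq)]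
  simp only [partialDeriv_zero_prod hq']

lemma IsWeakPartial.prod_one (h1 : IsWeakPartial (Qo T) 1 f D1) (hST : S < T)
    (hψ : ContDiff ℝ ∞ ψ) (hψS : tsupport ψ ⊆ Icc (-S) S)
    {q : AddCircle (2 * Real.pi) → ℝ} (hq : ContDiff ℝ ∞ fun s : ℝ => q s) :
    ∫ x : Cyl, (deriv ψ x.2 * q x.1) • f x = - ∫ x : Cyl, (ψ x.2 * q x.1) • D1 x := by
  rw [← h1.byParts _ (isTest_prod hST hψ hψS hq)]
  simp only [partialDeriv_one_prod hψ]

lemma IsWeakPartial.integrableOn_Q (h0 : IsWeakPartial (Qo T) 0 f D0) (hST : S < T) :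
    IntegrableOn f (Q S) ∧ IntegrableOn D0 (Q S) :=
  ⟨h0.locInt.integrableOn_compact_subset (Q_subset_Qo hST) (isCompact_Q S),
    h0.locInt_deriv.integrableOn_compact_subset (Q_subset_Qo hST) (isCompact_Q S)⟩

/-- The weak Laplacian tested against `ψ(t) r(θ)` with `r'' = -k² r`. -/
lemma integral_laplacian_prod (h0 : IsWeakPartial (Qo T) 0 f D0) (h1 : IsWeakPartial (Qo T) 1 f D1)
    (h00 : IsWeakPartial (Qo T) 0 D0 L0) (h11 : IsWeakPartial (Qo T) 1 D1 L1) (hST : S < T)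
    (hψ : ContDiff ℝ ∞ ψ) (hψS : tsupport ψ ⊆ Icc (-S) S) {k c : ℝ}
    {r r₁ : AddCircle (2 * Real.pi) → ℝ} (hr : ContDiff ℝ ∞ fun s : ℝ => r s)
    (hr₁ : ContDiff ℝ ∞ fun s : ℝ => r₁ s)
    (hrc : Continuous r) (hrb : ∀ θ, |r θ| ≤ 1)
    (hd : ∀ y : ℝ, HasDerivAt (fun s : ℝ => r s) (c * r₁ y) y)
    (hd₁ : ∀ y : ℝ, HasDerivAt (fun s : ℝ => r₁ s) (-c * r y) y) (hc : c ^ 2 = k ^ 2) :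
    ∫ x : Cyl, (ψ x.2 * r x.1) • (L0 x + L1 x) =
      ∫ x : Cyl, ((deriv (deriv ψ) x.2 - k ^ 2 * ψ x.2) * r x.1) • f x := by
  have hψ1 : ContDiff ℝ ∞ (deriv ψ) := (contDiff_infty_iff_deriv.1 hψ).2
  have hψ2 : ContDiff ℝ ∞ (deriv (deriv ψ)) := (contDiff_infty_iff_deriv.1 hψ1).2
  have hψ1S : tsupport (deriv ψ) ⊆ Icc (-S) S := Subset.trans tsupport_deriv_subset hψS
  have hψ2S : tsupport (deriv (deriv ψ)) ⊆ Icc (-S) S := Subset.trans tsupport_deriv_subset hψ1S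
  have hf := (h0.integrableOn_Q hST).1
  have a1 := h00.prod_zero hST hψ hψS hr (q' := fun θ => c * r₁ θ) hd
  have a2 := h0.prod_zero hST hψ hψS hr₁ (q' := fun θ => -c * r θ) hd₁
  have b1 := h11.prod_one hST hψ hψS hr
  have b2 := h1.prod_one hST hψ1 hψ1S hr
  have iL0 := integrable_prod_smul hψ.continuous hψS hrc hrb
    (h00.locInt_deriv.integrableOn_compact_subset (Q_subset_Qo hST) (isCompact_Q S))
  have iL1 := integrable_prod_smul hψ.continuous hψS hrc hrb
    (h11.locInt_deriv.integrableOn_compact_subset (Q_subset_Qo hST) (isCompact_Q S))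
  have i2 := integrable_prod_smul hψ2.continuous hψ2S hrc hrb hf
  have i0 := integrable_prod_smul hψ.continuous hψS hrc hrb hf
  -- Two integrations by parts in `θ` give `-c² = -k²`. Keeping `c` signed treats sine and cosine
  -- together.
  have e0 : ∫ x : Cyl, (ψ x.2 * r x.1) • L0 x = -(k ^ 2 • ∫ x : Cyl, (ψ x.2 * r x.1) • f x) := by
    have c1 : ∫ x : Cyl, (ψ x.2 * (c * r₁ x.1)) • D0 x
        = c • ∫ x : Cyl, (ψ x.2 * r₁ x.1) • D0 x := by
      rw [← integral_smul]; congr 1; ext1 x; rw [smul_smul]; congr 1; ring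
    have c2 : ∫ x : Cyl, (ψ x.2 * (-c * r x.1)) • f x
        = (-c) • ∫ x : Cyl, (ψ x.2 * r x.1) • f x := by
      rw [← integral_smul]; congr 1; ext1 x; rw [smul_smul]; congr 1; ring
    rw [c1] at a1
    rw [c2] at a2
    rw [← neg_eq_iff_eq_neg] at a1 a2
    rw [← a1, ← a2, smul_neg, neg_neg, smul_smul, ← neg_smul]
    congr 1
    linear_combination -hc
  have i0' : Integrable fun x : Cyl => k ^ 2 • ((ψ x.2 * r x.1) • f x) := i0.smul (k ^ 2)
  simp only [smul_add]
  rw [integral_add iL0 iL1, e0]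
  have e1 : ∫ x : Cyl, (ψ x.2 * r x.1) • L1 x = ∫ x : Cyl, (deriv (deriv ψ) x.2 * r x.1) • f x := by
    rw [b2, b1, neg_neg]
  rw [e1, ← integral_smul, neg_add_eq_sub, ← integral_sub i2 i0']
  congr 1; ext1 x
  rw [smul_smul, ← sub_smul]; congr 1; ring

/-- The mode equations for `D = ∂_θ f` and `L = Δf`, up to modification on null sets. -/
theorem modeEq_of_isWeakPartial (h0 : IsWeakPartial (Qo T) 0 f D0)
    (h1 : IsWeakPartial (Qo T) 1 f D1) (h00 : IsWeakPartial (Qo T) 0 D0 L0)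
    (h11 : IsWeakPartial (Qo T) 1 D1 L1) (hST : S < T)
    {D L : Cyl → EuclideanSpace ℝ (Fin n)}
    (hD : ∀ᵐ x ∂(volume.restrict (Q S)), D x = D0 x)
    (hL : ∀ᵐ x ∂(volume.restrict (Q S)), L x = L0 x + L1 x) (j : Fin n) :
    ModeEq S (fun x => D x j) (fun x => L x j) := by
  have hm : MeasurableSet (Q S) := (isCompact_Q S).measurableSet
  have hD0 : IntegrableOn D0 (Q S) := (h0.integrableOn_Q hST).2
  have hLi : IntegrableOn (fun x => L0 x + L1 x) (Q S) :=
    (h00.locInt_deriv.integrableOn_compact_subset (Q_subset_Qo hST) (isCompact_Q S)).add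
      (h11.locInt_deriv.integrableOn_compact_subset (Q_subset_Qo hST) (isCompact_Q S))
  have comp : ∀ {g g' : Cyl → EuclideanSpace ℝ (Fin n)} {ψ : ℝ → ℝ}
      {q : AddCircle (2 * Real.pi) → ℝ}, IntegrableOn g' (Q S) →
      (∀ᵐ x ∂(volume.restrict (Q S)), g x = g' x) → Continuous ψ → tsupport ψ ⊆ Icc (-S) S →
      Continuous q → (∀ θ, |q θ| ≤ 1) →
      ∫ x : Cyl, (ψ x.2 * q x.1) * g x j = (∫ x : Cyl, (ψ x.2 * q x.1) • g' x) j := by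
    intro g g' ψ q hg' hgg hψ hψS hq hq1
    have hi := integrable_prod_smul hψ hψS hq hq1 hg'
    have h := (EuclideanSpace.proj (𝕜 := ℝ) j :
      EuclideanSpace ℝ (Fin n) →L[ℝ] ℝ).integral_comp_comm hi
    refine Eq.trans ?_ h
    refine integral_congr_ae ?_
    filter_upwards [(ae_restrict_iff' hm).1 hgg] with x hx
    by_cases hxS : x ∈ Q S
    · simp [hx hxS]
    · have : ψ x.2 = 0 := by
        by_contra h0
        exact hxS ⟨mem_univ _, hψS (subset_tsupport _ h0)⟩
      simp [this]
  have key : ∀ {ψ : ℝ → ℝ} {k : ℝ}, ContDiff ℝ ∞ ψ → tsupport ψ ⊆ Icc (-S) S →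
      ContDiff ℝ ∞ (fun t => deriv (deriv ψ) t - k ^ 2 * ψ t) ∧
      tsupport (fun t => deriv (deriv ψ) t - k ^ 2 * ψ t) ⊆ Icc (-S) S := by
    intro ψ k hψ hψS
    have hψ1 : ContDiff ℝ ∞ (deriv ψ) := (contDiff_infty_iff_deriv.1 hψ).2
    have hψ2 : ContDiff ℝ ∞ (deriv (deriv ψ)) := (contDiff_infty_iff_deriv.1 hψ1).2
    refine ⟨hψ2.sub (contDiff_const.mul hψ), (closure_minimal (fun t ht => ?_)
      (isClosed_tsupport ψ)).trans hψS⟩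
    by_contra h
    have e1 : ψ t = 0 := image_eq_zero_of_notMem_tsupport h
    have e2 : deriv (deriv ψ) t = 0 := image_eq_zero_of_notMem_tsupport fun h' =>
      h (tsupport_deriv_subset (tsupport_deriv_subset h'))
    exact ht (by simp [e1, e2])
  -- Both sides of a mode equation are reduced to integrals of `f`: one `θ`-derivative is moved off
  -- `D`, two derivatives off `L`. No third derivative of `f` is needed.
  refine ⟨fun k ψ hψ hψS => ?_, fun k ψ hψ hψS => ?_, fun ψ hψ hψS => ?_⟩
  · obtain ⟨hχ, hχS⟩ := key (k := k) hψ hψS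
    rw [comp (ψ := fun t => deriv (deriv ψ) t - (k : ℝ) ^ 2 * ψ t) hD0 hD hχ.continuous hχS
      (continuous_sinMode k) (abs_sinMode_le k),
      comp hLi hL hψ.continuous hψS (continuous_cosMode k) (abs_cosMode_le k),
      integral_laplacian_prod h0 h1 h00 h11 hST hψ hψS (k := k) (c := -k) (contDiff_cosMode k)
        (contDiff_sinMode k) (continuous_cosMode k) (abs_cosMode_le k) (hasDerivAt_cosMode k)
        (by simpa using hasDerivAt_sinMode k) (by ring)]
    have := h0.prod_zero hST hχ hχS (contDiff_sinMode k) (q' := fun θ => (k : ℝ) * cosMode k θ)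
      (hasDerivAt_sinMode k)
    rw [← neg_eq_iff_eq_neg] at this
    rw [← this]
    have e : ∫ x : Cyl, ((deriv (deriv ψ) x.2 - (k : ℝ) ^ 2 * ψ x.2) * ((k : ℝ) * cosMode k x.1))
        • f x = (k : ℝ) • ∫ x : Cyl, ((deriv (deriv ψ) x.2 - (k : ℝ) ^ 2 * ψ x.2) * cosMode k x.1)
        • f x := by
      rw [← integral_smul]; congr 1; ext1 x; rw [smul_smul]; congr 1; ring
    rw [e]; simp
  · obtain ⟨hχ, hχS⟩ := key (k := k) hψ hψS
    rw [comp (ψ := fun t => deriv (deriv ψ) t - (k : ℝ) ^ 2 * ψ t) hD0 hD hχ.continuous hχS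
      (continuous_cosMode k) (abs_cosMode_le k),
      comp hLi hL hψ.continuous hψS (continuous_sinMode k) (abs_sinMode_le k),
      integral_laplacian_prod h0 h1 h00 h11 hST hψ hψS (k := k) (c := k) (contDiff_sinMode k)
        (contDiff_cosMode k) (continuous_sinMode k) (abs_sinMode_le k) (hasDerivAt_sinMode k)
        (hasDerivAt_cosMode k) rfl]
    have := h0.prod_zero hST hχ hχS (contDiff_cosMode k) (q' := fun θ => -(k : ℝ) * sinMode k θ)
      (hasDerivAt_cosMode k)
    rw [← neg_eq_iff_eq_neg] at this
    rw [← this]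
    have e : ∫ x : Cyl, ((deriv (deriv ψ) x.2 - (k : ℝ) ^ 2 * ψ x.2) * (-(k : ℝ) * sinMode k x.1))
        • f x = (-(k : ℝ)) • ∫ x : Cyl, ((deriv (deriv ψ) x.2 - (k : ℝ) ^ 2 * ψ x.2)
          * sinMode k x.1) • f x := by
      rw [← integral_smul]; congr 1; ext1 x; rw [smul_smul]; congr 1; ring
    rw [e]; simp
  · have h := comp hD0 hD hψ.continuous hψS (continuous_cosMode 0) (abs_cosMode_le 0)
    have := h0.prod_zero hST hψ hψS (contDiff_cosMode 0) (q' := fun θ => -((0 : ℤ) : ℝ) * sinMode 0 θ)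
      (hasDerivAt_cosMode 0)
    rw [← neg_eq_iff_eq_neg] at this
    rw [← this] at h
    simpa [cosMode] using h

end weak

/-! ### Cut-offs and summation over unit intervals -/

/-- Cut-off functions on `[-S, S]` with derivative bounds independent of `S`. -/
lemma exists_cutoff : ∃ K : ℝ, ∀ S : ℝ, ∃ η : ℝ → ℝ, ContDiff ℝ ∞ η ∧
    tsupport η ⊆ Icc (-S) S ∧ (∀ t, |η t| ≤ 1) ∧ (∀ t, |t| ≤ S - 1 → η t = 1) ∧
    ∀ t, |deriv η t| + |deriv (deriv η) t| ≤ K := by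
  set σ := Real.smoothTransition with hσ
  have s0 : ContDiff ℝ ∞ σ := Real.smoothTransition.contDiff
  have s1 : ContDiff ℝ ∞ (deriv σ) := (contDiff_infty_iff_deriv.1 s0).2
  have s2 : ContDiff ℝ ∞ (deriv (deriv σ)) := (contDiff_infty_iff_deriv.1 s1).2
  have hc : HasCompactSupport (deriv σ) := by
    refine HasCompactSupport.intro (K := Icc 0 1) isCompact_Icc fun x hx => ?_
    rw [mem_Icc, not_and_or, not_le, not_le] at hx
    rcases hx with hx | hx
    · have : σ =ᶠ[nhds x] fun _ => 0 := by
        filter_upwards [Iio_mem_nhds hx] with y hy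
        exact Real.smoothTransition.zero_of_nonpos (le_of_lt hy)
      rw [this.deriv_eq, deriv_const]
    · have : σ =ᶠ[nhds x] fun _ => 1 := by
        filter_upwards [Ioi_mem_nhds hx] with y hy
        exact Real.smoothTransition.one_of_one_le (le_of_lt hy)
      rw [this.deriv_eq, deriv_const]
  obtain ⟨B1, hB1⟩ := hc.exists_bound_of_continuous s1.continuous
  obtain ⟨B2, hB2⟩ := hc.deriv.exists_bound_of_continuous s2.continuous
  have hσ1 : ∀ x, |σ x| ≤ 1 := fun x => by
    rw [abs_of_nonneg (Real.smoothTransition.nonneg x)]; exact Real.smoothTransition.le_one x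
  refine ⟨2 * B1 + (2 * B2 + 2 * B1 ^ 2), fun S => ?_⟩
  have dp : ∀ {u u' : ℝ → ℝ}, (∀ x, HasDerivAt u (u' x) x) → ∀ t,
      HasDerivAt (fun t => u (S + t)) (u' (S + t)) t := fun h t => (h (S + t)).comp_const_add S t
  have dm : ∀ {u u' : ℝ → ℝ}, (∀ x, HasDerivAt u (u' x) x) → ∀ t,
      HasDerivAt (fun t => u (S - t)) (-u' (S - t)) t := fun h t => (h (S - t)).comp_const_sub S t
  have d0 : ∀ x, HasDerivAt σ (deriv σ x) x := fun x =>
    (s0.differentiable (by simp) x).hasDerivAt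
  have d1 : ∀ x, HasDerivAt (deriv σ) (deriv (deriv σ) x) x := fun x =>
    (s1.differentiable (by simp) x).hasDerivAt
  have e1 : deriv (fun t => σ (S - t) * σ (S + t))
      = fun t => -deriv σ (S - t) * σ (S + t) + σ (S - t) * deriv σ (S + t) :=
    funext fun t => ((dm d0 t).mul (dp d0 t)).deriv
  have e2 : ∀ t, deriv (deriv (fun t => σ (S - t) * σ (S + t))) t
      = deriv (deriv σ) (S - t) * σ (S + t) - 2 * (deriv σ (S - t) * deriv σ (S + t))
        + σ (S - t) * deriv (deriv σ) (S + t) := fun t => by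
    rw [e1]
    refine ((((dm d1 t).neg).mul (dp d0 t)).add ((dm d0 t).mul (dp d1 t))).deriv.trans ?_
    simp only [Pi.neg_apply]
    ring
  -- One transition at each end. Since only translates and a reflection of a fixed profile occur,
  -- the derivative bounds do not depend on `S`.
  refine ⟨fun t => σ (S - t) * σ (S + t), (s0.comp (contDiff_const.sub contDiff_id)).mul
    (s0.comp (contDiff_const.add contDiff_id)), ?_, ?_, ?_, ?_⟩
  · refine closure_minimal (fun t ht => ?_) isClosed_Icc
    constructor
    · by_contra h
      exact ht (by simp [hσ, Real.smoothTransition.zero_of_nonpos (show S + t ≤ 0 by linarith)])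
    · by_contra h
      exact ht (by simp [hσ, Real.smoothTransition.zero_of_nonpos (show S - t ≤ 0 by linarith)])
  · intro t
    rw [abs_mul]
    exact mul_le_one₀ (hσ1 _) (abs_nonneg _) (hσ1 _)
  · intro t ht
    rw [abs_le] at ht
    simp only [hσ]
    rw [Real.smoothTransition.one_of_one_le (by linarith),
      Real.smoothTransition.one_of_one_le (by linarith), mul_one]
  · intro t
    have m : ∀ {x y X Y : ℝ}, |x| ≤ X → |y| ≤ Y → |x * y| ≤ X * Y := fun hx hy => by
      rw [abs_mul]; exact mul_le_mul hx hy (abs_nonneg _) ((abs_nonneg _).trans hx)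
    rw [e2, e1]
    refine add_le_add ?_ ?_
    · have a1 := m (by simpa using hB1 (S - t) : |-deriv σ (S - t)| ≤ B1) (hσ1 (S + t))
      have a2 := m (hσ1 (S - t)) (hB1 (S + t))
      refine (abs_add_le _ _).trans ?_
      linarith
    · have a1 := m (hB2 (S - t)) (hσ1 (S + t))
      have a2 := m (hσ1 (S - t)) (hB2 (S + t))
      have a3 := m (hB1 (S - t)) (hB1 (S + t))
      refine (abs_add_le _ _).trans ?_
      have a4 := abs_sub (deriv (deriv σ) (S - t) * σ (S + t)) (2 * (deriv σ (S - t) * deriv σ (S + t)))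
      rw [abs_mul 2, abs_two] at a4
      linarith

/-- Summing exponentially weighted bounds over unit intervals. -/
lemma lintegral_le_of_unit_intervals {g : ℝ → ℝ≥0∞} (hg : Measurable g) {M : ℝ≥0∞}
    (h : ∀ τ, ∫⁻ s in Icc τ (τ + 1), g s ≤ M * ENNReal.ofReal (Real.exp |τ|)) {t : ℝ}
    (ht : 0 ≤ t) :
    ∫⁻ s in Icc (-t) t, g s ≤ M * ENNReal.ofReal (2 * Real.exp (t + 1)) := by
  have hA : -(t + 1) ≤ t + 1 := by linarith
  have e : ∀ τ, ∫⁻ s in Icc τ (τ + 1), g s = ∫⁻ s, (Icc τ (τ + 1)).indicator g s := fun τ =>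
    (lintegral_indicator measurableSet_Icc _).symm
  have hmeas : Measurable fun z : ℝ × ℝ => (Icc z.1 (z.1 + 1)).indicator g z.2 := by
    have : (fun z : ℝ × ℝ => (Icc z.1 (z.1 + 1)).indicator g z.2)
        = ({z : ℝ × ℝ | z.1 ≤ z.2 ∧ z.2 ≤ z.1 + 1}).indicator (fun z => g z.2) := by
      ext z
      by_cases hz : z.1 ≤ z.2 ∧ z.2 ≤ z.1 + 1
      · rw [indicator_of_mem (show z.2 ∈ Icc z.1 (z.1 + 1) from hz),
          indicator_of_mem (show z ∈ {z : ℝ × ℝ | z.1 ≤ z.2 ∧ z.2 ≤ z.1 + 1} from hz)]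
      · rw [indicator_of_notMem (show z.2 ∉ Icc z.1 (z.1 + 1) from hz),
          indicator_of_notMem (show z ∉ {z : ℝ × ℝ | z.1 ≤ z.2 ∧ z.2 ≤ z.1 + 1} from hz)]
    rw [this]
    refine (hg.comp measurable_snd).indicator ?_
    exact (measurableSet_le measurable_fst measurable_snd).inter
      (measurableSet_le measurable_snd (measurable_fst.add_const 1))
  have hcontr : ∫⁻ τ in Icc (-(t + 1)) (t + 1), ENNReal.ofReal (Real.exp |τ|)
      ≤ ENNReal.ofReal (2 * Real.exp (t + 1)) := by
    have hint : IntegrableOn (fun τ : ℝ => Real.exp τ + Real.exp (-τ)) (Icc (-(t + 1)) (t + 1)) :=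
      (by fun_prop : Continuous fun τ : ℝ => Real.exp τ + Real.exp (-τ)).continuousOn.integrableOn_Icc
    calc ∫⁻ τ in Icc (-(t + 1)) (t + 1), ENNReal.ofReal (Real.exp |τ|)
        ≤ ∫⁻ τ in Icc (-(t + 1)) (t + 1), ENNReal.ofReal (Real.exp τ + Real.exp (-τ)) := by
          refine lintegral_mono fun τ => ENNReal.ofReal_le_ofReal ?_
          rcases abs_cases τ with h | h <;> rw [h.1] <;>
            linarith [Real.exp_pos τ, Real.exp_pos (-τ)]
      _ = ENNReal.ofReal (∫ τ in Icc (-(t + 1)) (t + 1), (Real.exp τ + Real.exp (-τ))) :=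
          (ofReal_integral_eq_lintegral_ofReal hint
            (Filter.Eventually.of_forall fun τ => by simp only [Pi.zero_apply]; positivity)).symm
      _ ≤ _ := by
          refine ENNReal.ofReal_le_ofReal ?_
          rw [integral_Icc_eq_integral_Ioc, ← intervalIntegral.integral_of_le hA,
            intervalIntegral.integral_add (Continuous.intervalIntegrable (by fun_prop) _ _)
              (Continuous.intervalIntegrable (by fun_prop) _ _),
            intervalIntegral.integral_comp_neg (fun x => Real.exp x)]
          simp only [integral_exp, neg_neg]
          linarith [Real.exp_pos (-(t + 1))]
  calc ∫⁻ s in Icc (-t) t, g s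
      ≤ ∫⁻ s, ∫⁻ τ in Icc (-(t + 1)) (t + 1), (Icc τ (τ + 1)).indicator g s := by
        rw [← lintegral_indicator measurableSet_Icc]
        refine lintegral_mono fun s => ?_
        by_cases hs : s ∈ Icc (-t) t
        · rw [indicator_of_mem hs]
          -- Averaging over the starting point `τ` replaces a partition into unit intervals: the
          -- admissible `τ` for a given `s` form an interval of length one.
          calc g s = ∫⁻ _τ in Icc (s - 1) s, g s := by simp
            _ ≤ ∫⁻ τ in Icc (s - 1) s, (Icc τ (τ + 1)).indicator g s := by
                refine setLIntegral_mono' measurableSet_Icc fun τ hτ => ?_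
                rw [indicator_of_mem (show s ∈ Icc τ (τ + 1) from ⟨hτ.2, by linarith [hτ.1]⟩)]
            _ ≤ _ := lintegral_mono_set (Icc_subset_Icc (by linarith [hs.1]) (by linarith [hs.2]))
        · rw [indicator_of_notMem hs]; exact zero_le
    _ = ∫⁻ τ in Icc (-(t + 1)) (t + 1), ∫⁻ s in Icc τ (τ + 1), g s := by
        simp only [e]
        rw [lintegral_lintegral_swap]
        exact (hmeas.comp measurable_swap).aemeasurable
    _ ≤ ∫⁻ τ in Icc (-(t + 1)) (t + 1), M * ENNReal.ofReal (Real.exp |τ|) :=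
        lintegral_mono fun τ => h τ
    _ = M * ∫⁻ τ in Icc (-(t + 1)) (t + 1), ENNReal.ofReal (Real.exp |τ|) :=
        lintegral_const_mul _ (by fun_prop)
    _ ≤ _ := by gcongr

/-! ### Conformality, the Willmore density and measurable representatives -/

/-- The real part of `∑ (∂f^j/∂z)²` is `(|∂_θ f|² - |∂_t f|²)/4`. -/
lemma norm_weakPartial_eq {U : Set Cyl} {f : Cyl → EuclideanSpace ℝ (Fin n)} {x : Cyl}
    (h : ∑ j : Fin n, dz U f x j ^ 2 = 0) : ‖weakPartial U 1 f x‖ ^ 2 = ‖weakPartial U 0 f x‖ ^ 2 := by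
  have hre := congrArg Complex.re h
  rw [Complex.re_sum] at hre
  have e : ∀ j, (dz U f x j ^ 2).re
      = (weakPartial U 0 f x j ^ 2 - weakPartial U 1 f x j ^ 2) / 4 := by
    intro j
    have : dz U f x j ^ 2 = (((weakPartial U 0 f x j ^ 2 - weakPartial U 1 f x j ^ 2) / 4 : ℝ) : ℂ)
        + ((-(weakPartial U 0 f x j * weakPartial U 1 f x j) / 2 : ℝ) : ℂ) * Complex.I := by
      rw [dz]; push_cast; ring_nf; rw [Complex.I_sq]; ring
    rw [this, Complex.add_re, Complex.ofReal_re, Complex.re_ofReal_mul, Complex.I_re, mul_zero,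
      add_zero]
  simp only [e, Complex.zero_re] at hre
  rw [← Finset.sum_div, Finset.sum_sub_distrib] at hre
  rw [EuclideanSpace.norm_sq_eq, EuclideanSpace.norm_sq_eq]
  simp only [Real.norm_eq_abs, sq_abs]
  linarith

lemma gradSq_eq_two_mul {U : Set Cyl} {f : Cyl → EuclideanSpace ℝ (Fin n)} {x : Cyl}
    (h : ∑ j : Fin n, dz U f x j ^ 2 = 0) : gradSq U f x = 2 * ‖weakPartial U 0 f x‖ ^ 2 := by
  rw [gradSq, Fin.sum_univ_two, norm_weakPartial_eq h]; ring

/-- The Willmore density in terms of `∂_θ f` and `Δf`. -/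
lemma norm_lap_sq_div_eq {U : Set Cyl} {f : Cyl → EuclideanSpace ℝ (Fin n)} {x : Cyl}
    (h : ∑ j : Fin n, dz U f x j ^ 2 = 0) :
    ‖lap U f x‖ ^ 2 / ‖weakPartial U 0 f x‖ ^ 2 =
      2 * (1 / 4 * (‖meanCurv U f x‖ ^ 2 * gradSq U f x)) := by
  have hg := gradSq_eq_two_mul h
  -- Where the gradient vanishes both sides are zero, the left one by the convention for division by
  -- zero.
  by_cases h0 : ‖weakPartial U 0 f x‖ ^ 2 = 0
  · rw [hg, h0]; simp
  · have hg0 : gradSq U f x ≠ 0 := by rw [hg]; positivity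
    rw [meanCurv, if_pos hg0, norm_smul, hg, mul_pow, Real.norm_eq_abs, sq_abs]
    field_simp
    ring

lemma ofReal_norm_sq {E : Type*} [SeminormedAddCommGroup E] (v : E) :
    ENNReal.ofReal (‖v‖ ^ 2) = ‖v‖ₑ ^ 2 := by
  rw [← ofReal_norm, ENNReal.ofReal_pow (norm_nonneg _)]

/-- Replaces data given almost everywhere on `Q S` by a globally defined measurable function, so
that slices and products are measurable; extension by zero makes all integrals global. -/
lemma exists_stronglyMeasurable_rep {S : ℝ} {g : Cyl → EuclideanSpace ℝ (Fin n)}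
    (hg : IntegrableOn g (Q S)) : ∃ g' : Cyl → EuclideanSpace ℝ (Fin n), StronglyMeasurable g' ∧
      Integrable g' ∧ (∀ᵐ x ∂(volume.restrict (Q S)), g' x = g x) ∧ ∀ x ∉ Q S, g' x = 0 := by
  have hm : MeasurableSet (Q S) := (isCompact_Q S).measurableSet
  refine ⟨(Q S).indicator (hg.aestronglyMeasurable.mk g),
    hg.aestronglyMeasurable.stronglyMeasurable_mk.indicator hm, ?_, ?_, fun x hx =>
      indicator_of_notMem hx _⟩
  · exact IntegrableOn.integrable_indicator (hg.congr hg.aestronglyMeasurable.ae_eq_mk) hm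
  · filter_upwards [hg.aestronglyMeasurable.ae_eq_mk, ae_restrict_mem hm] with x hx hxS
    rw [indicator_of_mem hxS, hx]

lemma setLIntegral_strip {w : Cyl → ℝ≥0∞} (hw : Measurable w) (I : Set ℝ) :
    ∫⁻ t in I, ∫⁻ θ, w (θ, t) = ∫⁻ x in univ ×ˢ I, w x := by
  rw [Measure.volume_eq_prod, ← Measure.prod_restrict, Measure.restrict_univ,
    lintegral_prod_symm _ hw.aemeasurable]

/-- Hölder on a strip of area `2πρ`. This is the a priori Morrey bound with exponent `1 - 1/p`. -/
lemma lintegral_strip_le_Lp {p : ℝ≥0∞} (hp : 1 ≤ p) {l : Cyl → EuclideanSpace ℝ (Fin n)}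
    (hl : StronglyMeasurable l) (c : ℝ) {ρ : ℝ} (hρ : 0 < ρ) :
    ∫⁻ t in Icc c (c + ρ), ∫⁻ θ, ‖l (θ, t)‖ₑ ≤
      eLpNorm l p volume * ENNReal.ofReal (2 * Real.pi) ^ (1 - 1 / p.toReal)
        * ENNReal.ofReal (ρ ^ (1 - 1 / p.toReal)) := by
  have hnn : 0 ≤ 1 - 1 / p.toReal := by
    rcases eq_or_ne p ⊤ with rfl | h
    · simp
    · have : 1 ≤ p.toReal := by
        rw [← ENNReal.toReal_one]; exact ENNReal.toReal_mono h hp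
      have := div_le_one_of_le₀ this (by positivity)
      linarith
  rw [setLIntegral_strip hl.measurable.enorm]
  have h := eLpNorm_le_eLpNorm_mul_rpow_measure_univ (p := 1) (q := p)
    (μ := volume.restrict (univ ×ˢ Icc c (c + ρ) : Set Cyl)) (f := l) hp
    hl.aestronglyMeasurable
  rw [eLpNorm_one_eq_lintegral_enorm, Measure.restrict_apply_univ, Measure.volume_eq_prod,
    Measure.prod_prod, AddCircle.measure_univ, Real.volume_Icc, add_sub_cancel_left,
    ENNReal.toReal_one, div_one, ENNReal.mul_rpow_of_nonneg _ _ hnn,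
    ENNReal.ofReal_rpow_of_pos hρ, ← mul_assoc] at h
  refine h.trans ?_
  gcongr
  exact Measure.restrict_le_self

/-- The Sobolev condition gives second derivatives in `L^p_loc` of some first derivative; they are
transferred to the chosen one, `weakPartial`. -/
lemma MemSobolevLoc.exists_second {p : ℝ≥0∞} {U : Set Cyl} {f : Cyl → EuclideanSpace ℝ (Fin n)}
    (h : MemSobolevLoc p U 2 f) (i : Fin 2) :
    IsWeakPartial U i f (weakPartial U i f) ∧
      ∃ l, IsWeakPartial U i (weakPartial U i f) l ∧ MemLpLoc p U l := by
  obtain ⟨g, hg, hg2⟩ := h.2 i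
  obtain ⟨l, hl, hl2⟩ := hg2.2 i
  have h1 := isWeakPartial_weakPartial hg
  exact ⟨h1, l, hg.of_isWeakPartial h1 hl, hl2⟩

lemma energy_mono (U : Set Cyl) (f : Cyl → EuclideanSpace ℝ (Fin n)) {A B : Set Cyl} (h : A ⊆ B) :
    energy U f A ≤ energy U f B := lintegral_mono_set h

lemma Q_mono {s t : ℝ} (h : s ≤ t) : Q s ⊆ Q t :=
  prod_mono subset_rfl (Icc_subset_Icc (neg_le_neg h) h)

/-- Every interval of length one meets `[-S, S]` inside a unit interval contained in `[-T, T]`. -/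
lemma exists_window {S T : ℝ} (hST : S ≤ T) (hT : 1 ≤ T) (c : ℝ) :
    ∃ c' ∈ Icc (-T) (T - 1), Icc c (c + 1) ∩ Icc (-S) S ⊆ Icc c' (c' + 1) := by
  rcases lt_or_ge c (-T) with h | h
  · exact ⟨-T, ⟨le_rfl, by linarith⟩, fun x hx => ⟨by linarith [hx.2.1], by linarith [hx.1.2]⟩⟩
  · rcases le_or_gt c (T - 1) with h' | h'
    · exact ⟨c, ⟨h, h'⟩, fun x hx => hx.1⟩
    · exact ⟨T - 1, ⟨by linarith, le_rfl⟩, fun x hx =>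
        ⟨by linarith [hx.1.1], by linarith [hx.2.2]⟩⟩

/-! ### The decay estimate -/

/-- The constant of the decay estimate. -/
def decayConst (n : ℕ) (α K : ℝ) : ℝ≥0∞ :=
  ENNReal.ofReal (Real.exp 1) * (4 * (4 * n) * morreyConst α *
    (ENNReal.ofReal (2 * Real.pi) ^ (1 / 2 : ℝ) * ENNReal.ofReal K) ^ 2)

lemma decayConst_ne_top (n : ℕ) (α K : ℝ) : decayConst n α K ≠ ⊤ := by
  unfold decayConst
  refine ENNReal.mul_ne_top ENNReal.ofReal_ne_top (ENNReal.mul_ne_top (ENNReal.mul_ne_top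
    (ENNReal.mul_ne_top (by simp) (ENNReal.mul_ne_top (by simp) (by simp)))
    (morreyConst_ne_top α)) (ENNReal.pow_ne_top (ENNReal.mul_ne_top ?_ ENNReal.ofReal_ne_top)))
  exact ENNReal.rpow_ne_top_of_nonneg (by norm_num) ENNReal.ofReal_ne_top

/-- Energy decay away from the ends of the cylinder. -/
theorem energy_decay {p : ℝ≥0∞} (hp1 : 1 < p) (hp2 : p < 2) {K : ℝ}
    {R T δ : ℝ} (hT : 1 ≤ T) {η : ℝ → ℝ}
    (hη : ContDiff ℝ ∞ η) (hηS : tsupport η ⊆ Icc (-(T - 1)) (T - 1)) (hη1 : ∀ t, |η t| ≤ 1)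
    (hηeq : ∀ t, |t| ≤ T - 1 - 1 → η t = 1)
    (hηK : ∀ t, |deriv η t| + |deriv (deriv η) t| ≤ K)
    {f : Cyl → EuclideanSpace ℝ (Fin n)} (hf : MemFConf p (Qo T) R f)
    (hE : energy (Qo T) f (Q T) ≠ ⊤)
    (hW : ∀ t ∈ Icc (-T) (T - 1),
      willmore (Qo T) f (univ ×ˢ Icc t (t + 1)) ≤ ENNReal.ofReal δ)
    (hsmall : (4 * n) * morreyConst (1 - 1 / p.toReal) * (2 * (2 * ENNReal.ofReal δ)) ≤ 1 / 2)
    {t : ℝ} (ht : 0 ≤ t) (htT : t ≤ T - 2) :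
    energy (Qo T) f (Q t) ≤ 2 * (decayConst n (1 - 1 / p.toReal) K * energy (Qo T) f (Q T) *
      ENNReal.ofReal (Real.exp (-(T - 1 - 1))) * ENNReal.ofReal (2 * Real.exp (t + 1))) := by
  set U := Qo T with hU
  have hST : T - 1 < T := by linarith
  have hm : MeasurableSet (Q (T - 1)) := (isCompact_Q _).measurableSet
  have hptop : p ≠ ⊤ := (hp2.trans_le le_top).ne
  have hpr1 : 1 < p.toReal := by
    rw [← ENNReal.toReal_one]; exact (ENNReal.toReal_lt_toReal (by simp) hptop).2 hp1
  have hpr2 : p.toReal < 2 := by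
    have := (ENNReal.toReal_lt_toReal hptop (by simp)).2 hp2
    simpa using this
  have hα0 : 0 < 1 - 1 / p.toReal := by
    have := (div_lt_one (by linarith : 0 < p.toReal)).2 hpr1
    linarith
  have hα1 : 1 - 1 / p.toReal < 1 / 2 := by
    have := one_div_lt_one_div_of_lt (by linarith : 0 < p.toReal) hpr2
    linarith
  obtain ⟨h0, l0, hl0, hl0p⟩ := hf.memF.sobolev.exists_second 0
  obtain ⟨h1, l1, hl1, hl1p⟩ := hf.memF.sobolev.exists_second 1
  have h00 := isWeakPartial_weakPartial hl0
  have h11 := isWeakPartial_weakPartial hl1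
  have hlap : ∀ x, lap U f x = weakPartial U 0 (weakPartial U 0 f) x
      + weakPartial U 1 (weakPartial U 1 f) x := fun x => by rw [lap, Fin.sum_univ_two]
  have hQU : Q (T - 1) ⊆ U := Q_subset_Qo hST
  have hint : ∀ {i : Fin 2} {u v : Cyl → EuclideanSpace ℝ (Fin n)}, IsWeakPartial U i u v →
      IntegrableOn v (Q (T - 1)) := fun h =>
    h.locInt_deriv.integrableOn_compact_subset hQU (isCompact_Q _)
  obtain ⟨D, hDm, hDi, hDae, hD0⟩ := exists_stronglyMeasurable_rep (hint h0)
  obtain ⟨N, hNm, hNi, hNae, hN0⟩ := exists_stronglyMeasurable_rep ((hint h00).add (hint h11))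
  -- Two versions of the Laplacian are kept: `l`, from derivatives in `L^p_loc`, and `N`, from the
  -- derivatives entering `lap`. Both satisfy the mode equations, so their almost everywhere
  -- equality need not be proved.
  obtain ⟨l, hlm, hli, hlae, hl0'⟩ := exists_stronglyMeasurable_rep ((hint hl0).add (hint hl1))
  have hconf : ∀ᵐ x ∂(volume.restrict (Q (T - 1))), ∑ j : Fin n, dz U f x j ^ 2 = 0 :=
    ae_mono (Measure.restrict_mono hQU le_rfl) hf.conformal
  have hDset : MeasurableSet {x | D x ≠ 0} :=
    hDm.measurable (measurableSet_singleton (0 : EuclideanSpace ℝ (Fin n))).compl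
  -- Setting `L` to zero where `D = 0` makes `|L| = (|L|²/|D|²)^{1/2} |D|` hold everywhere. It
  -- changes nothing almost everywhere on `Q (T - 1)`, because `|Δf| ≤ β|∇f|²` forces `Δf = 0` where
  -- the gradient vanishes.
  set L : Cyl → EuclideanSpace ℝ (Fin n) := {x | D x ≠ 0}.indicator N with hLdef
  have hLm : StronglyMeasurable L := hNm.indicator hDset
  have hLi : Integrable L := hNi.indicator hDset
  have hLz : ∀ x, D x = 0 → L x = 0 := fun x hx => indicator_of_notMem (by simpa using hx) _
  have hLlap : ∀ᵐ x ∂(volume.restrict (Q (T - 1))), L x = lap U f x := by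
    obtain ⟨β, -, -, hβ, -⟩ := hf.memF.laplace
    filter_upwards [hDae, hNae, hconf, ae_mono (Measure.restrict_mono hQU le_rfl) hβ]
      with x hx1 hx2 hx3 hx4
    by_cases hx : D x = 0
    · rw [hLz x hx]
      rw [gradSq_eq_two_mul hx3, ← hx1, hx] at hx4
      simp only [norm_zero, ne_eq, OfNat.ofNat_ne_zero, not_false_eq_true, zero_pow, mul_zero] at hx4
      exact (norm_le_zero_iff.1 hx4).symm
    · rw [hLdef, indicator_of_mem (by exact hx), hx2, hlap]; rfl
  have hmodeL : ∀ j, ModeEq (T - 1) (fun x => D x j) (fun x => L x j) :=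
    modeEq_of_isWeakPartial h0 h1 h00 h11 hST hDae
      (by filter_upwards [hLlap] with x hx; rw [hx, hlap])
  have hmodel : ∀ j, ModeEq (T - 1) (fun x => D x j) (fun x => l x j) :=
    modeEq_of_isWeakPartial h0 h1 hl0 hl1 hST hDae hlae
  set a : ℝ → ℝ≥0∞ := fun t => ∫⁻ θ, ‖D (θ, t)‖ₑ ^ 2 with ha
  set w : Cyl → ℝ≥0∞ := fun x => ENNReal.ofReal (‖L x‖ ^ 2 / ‖D x‖ ^ 2) with hw
  set b : ℝ → ℝ≥0∞ := fun t => ∫⁻ θ, w (θ, t) with hb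
  have hD2m : Measurable fun x => ‖D x‖ₑ ^ 2 := hDm.measurable.enorm.pow_const 2
  have hwm : Measurable w :=
    ((hLm.measurable.norm.pow_const 2).div (hDm.measurable.norm.pow_const 2)).ennreal_ofReal
  have ham : Measurable a := Measurable.lintegral_prod_left' hD2m
  have hbm : Measurable b := Measurable.lintegral_prod_left' hwm
  have hlint : Measurable fun t => ∫⁻ θ, ‖l (θ, t)‖ₑ :=
    Measurable.lintegral_prod_left' hlm.measurable.enorm
  have hDE : ∫⁻ x, ‖D x‖ₑ ^ 2 ≤ energy U f (Q T) := by
    calc ∫⁻ x, ‖D x‖ₑ ^ 2 = ∫⁻ x in Q (T - 1), ‖D x‖ₑ ^ 2 := by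
          rw [← lintegral_indicator hm]
          congr 1; ext x
          by_cases hx : x ∈ Q (T - 1)
          · rw [indicator_of_mem hx]
          · rw [indicator_of_notMem hx, hD0 x hx]; simp
      _ ≤ ∫⁻ x in Q (T - 1), ENNReal.ofReal (gradSq U f x) := by
          refine lintegral_mono_ae ?_
          filter_upwards [hDae, hconf] with x hx1 hx2
          rw [← ofReal_norm_sq, hx1, gradSq_eq_two_mul hx2]
          refine ENNReal.ofReal_le_ofReal ?_
          nlinarith [sq_nonneg ‖weakPartial U 0 f x‖]
      _ ≤ _ := lintegral_mono_set (Q_mono (by linarith))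
  have hD2top : ∫⁻ x, ‖D x‖ₑ ^ 2 ≠ ⊤ := ne_top_of_le_ne_top hE hDE
  have haE : ∫⁻ s, a s ≤ energy U f (Q T) := by
    refine le_trans (le_of_eq ?_) hDE
    rw [Measure.volume_eq_prod, lintegral_prod_symm _ hD2m.aemeasurable]
  have hLle : ∀ s, ∫⁻ θ, ‖L (θ, s)‖ₑ ≤ b s ^ (1 / 2 : ℝ) * a s ^ (1 / 2 : ℝ) := by
    intro s
    have hsl : Measurable fun θ : AddCircle (2 * Real.pi) => ((θ, s) : Cyl) :=
      measurable_id.prodMk measurable_const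
    refine le_trans (lintegral_mono fun θ => ?_)
      (lintegral_sqrt_mul_sqrt_le _ (hwm.comp hsl).aemeasurable (hD2m.comp hsl).aemeasurable)
    simp only
    rw [← ENNReal.mul_rpow_of_nonneg _ _ (by norm_num)]
    by_cases hx : D (θ, s) = 0
    · rw [hLz _ hx]; simp
    · rw [hw, ← ofReal_norm_sq, ← ENNReal.ofReal_mul (by positivity), div_mul_cancel₀ _
        (by simpa using hx), ofReal_norm_sq, ENNReal_sqrt_sq]
  have hbδ : ∀ c, ∫⁻ s in Icc c (c + 1), b s ≤ 2 * ENNReal.ofReal δ := by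
    intro c
    -- `w` vanishes off `Q (T - 1)`, so a unit window reaching beyond `[-T, T]` may be replaced by
    -- one where the Willmore hypothesis applies.
    obtain ⟨c', hc', hsub⟩ := exists_window hST.le hT c
    calc ∫⁻ s in Icc c (c + 1), b s = ∫⁻ x in univ ×ˢ Icc c (c + 1), w x := setLIntegral_strip hwm _
      _ = ∫⁻ x in (univ ×ˢ Icc c (c + 1)) ∩ Q (T - 1), w x := by
          rw [inter_comm, ← setLIntegral_indicator hm]
          congr 1; ext x
          by_cases hx : x ∈ Q (T - 1)
          · rw [indicator_of_mem hx]
          · rw [indicator_of_notMem hx]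
            simp [hw, hD0 x hx]
      _ ≤ ∫⁻ x in (univ ×ˢ Icc c (c + 1)) ∩ Q (T - 1),
            2 * (1 / 4 * ENNReal.ofReal (‖meanCurv U f x‖ ^ 2 * gradSq U f x)) := by
          refine lintegral_mono_ae ?_
          filter_upwards [ae_mono (Measure.restrict_mono inter_subset_right le_rfl) hDae,
            ae_mono (Measure.restrict_mono inter_subset_right le_rfl) hLlap,
            ae_mono (Measure.restrict_mono inter_subset_right le_rfl) hconf] with x hx1 hx2 hx3
          simp only [hw]
          rw [hx1, hx2, norm_lap_sq_div_eq hx3, ENNReal.ofReal_mul (by norm_num),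
            ENNReal.ofReal_mul (by norm_num), ENNReal.ofReal_div_of_pos (by norm_num)]
          simp
      _ ≤ ∫⁻ x in univ ×ˢ Icc c' (c' + 1),
            2 * (1 / 4 * ENNReal.ofReal (‖meanCurv U f x‖ ^ 2 * gradSq U f x)) :=
          lintegral_mono_set fun x hx => ⟨mem_univ _, hsub ⟨hx.1.2, hx.2.2⟩⟩
      _ = 2 * willmore U f (univ ×ˢ Icc c' (c' + 1)) := by
          rw [lintegral_const_mul' _ _ (by simp), lintegral_const_mul' _ _ (by simp), willmore]
      _ ≤ _ := by gcongr; exact hW c' hc'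
  have hlp : eLpNorm l p volume ≠ ⊤ := by
    have e : l = (Q (T - 1)).indicator l := by
      ext1 x
      by_cases hx : x ∈ Q (T - 1)
      · rw [indicator_of_mem hx]
      · rw [indicator_of_notMem hx, hl0' x hx]
    rw [e, eLpNorm_indicator_eq_eLpNorm_restrict hm, eLpNorm_congr_ae hlae]
    exact ((hl0p _ (isCompact_Q _) hQU).add (hl1p _ (isCompact_Q _) hQU)).2.ne
  set e : ℝ → ℝ≥0∞ := fun s => ‖η s‖ₑ with he
  set c := ENNReal.ofReal (2 * Real.pi) ^ (1 / 2 : ℝ) with hc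
  have hctop : c ≠ ⊤ := ENNReal.rpow_ne_top_of_nonneg (by norm_num) ENNReal.ofReal_ne_top
  set d : ℝ → ℝ≥0∞ := fun s => c * (‖deriv η s‖ₑ + ‖deriv (deriv η) s‖ₑ) with hd
  have he1 : ∀ s, e s ≤ 1 := fun s => by
    rw [he, ← ENNReal.ofReal_one]
    simp only [← ofReal_norm]
    exact ENNReal.ofReal_le_ofReal (hη1 s)
  have hη1s : ContDiff ℝ ∞ (deriv η) := (contDiff_infty_iff_deriv.1 hη).2
  have hη2s : ContDiff ℝ ∞ (deriv (deriv η)) := (contDiff_infty_iff_deriv.1 hη1s).2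
  have hem : Measurable e := hη.continuous.measurable.enorm
  have hdm : Measurable d :=
    (hη1s.continuous.measurable.enorm.add hη2s.continuous.measurable.enorm).const_mul c
  -- The parameter `S` is `T - 2`: the cut-off equals one on `[-(T-2), T-2]`, so its derivatives
  -- vanish in the interior of that interval.
  have hdecay := exp_decay_of_potential_bound (α := 1 - 1 / p.toReal) hα0 hα1
    (c₀ := 4 * n) (K := c * ENNReal.ofReal K) (S := T - 1 - 1) (E := energy U f (Q T))
    (δ := 2 * ENNReal.ofReal δ) (G' := eLpNorm l p volume *
      ENNReal.ofReal (2 * Real.pi) ^ (1 - 1 / p.toReal))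
    (ENNReal.mul_ne_top (by simp) (by simp)) ham hbm hlint hem hdm
    (ENNReal.mul_ne_top hctop ENNReal.ofReal_ne_top) hE
    (by
      filter_upwards [circle_energy_le_expPot hDm hDi hLi hD2top hmodeL hη hηS] with t ht
      refine ht.trans ?_
      gcongr with k
      refine expPot_mono _ (fun s => ?_) t
      gcongr
      exact hLle s)
    (circle_energy_le_expPot hDm hDi hli hD2top hmodel hη hηS)
    (ENNReal.mul_ne_top hlp (ENNReal.rpow_ne_top_of_nonneg hα0.le ENNReal.ofReal_ne_top))
    (fun c ρ hρ _ => by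
      refine le_trans (lintegral_mono fun s => ?_) (lintegral_strip_le_Lp hp1.le hlm c hρ)
      exact mul_le_of_le_one_left zero_le (he1 s))
    (fun s => by
      simp only [hd]
      gcongr
      simp only [← ofReal_norm]
      rw [← ENNReal.ofReal_add (norm_nonneg _) (norm_nonneg _)]
      exact ENNReal.ofReal_le_ofReal (hηK s))
    (fun s hs => by
      have hopen : IsOpen {s : ℝ | |s| < T - 1 - 1} := isOpen_lt continuous_abs continuous_const
      have h1 : ∀ s, |s| < T - 1 - 1 → deriv η s = 0 := fun s hs => by
        have : η =ᶠ[nhds s] fun _ => 1 := by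
          filter_upwards [hopen.mem_nhds hs] with r hr
          exact hηeq r (le_of_lt hr)
        rw [this.deriv_eq, deriv_const]
      have h2 : deriv (deriv η) s = 0 := by
        have : deriv η =ᶠ[nhds s] fun _ => 0 := by
          filter_upwards [hopen.mem_nhds hs] with r hr
          exact h1 r hr
        rw [this.deriv_eq, deriv_const]
      simp [hd, h1 s hs, h2])
    hbδ haE hsmall
  have hunit : ∀ τ, ∫⁻ s in Icc τ (τ + 1), e s ^ 2 * a s ≤
      decayConst n (1 - 1 / p.toReal) K * energy U f (Q T) *
        ENNReal.ofReal (Real.exp (-(T - 1 - 1))) * ENNReal.ofReal (Real.exp |τ|) := by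
    intro τ
    refine (hdecay τ).trans (le_of_eq ?_)
    rw [decayConst, mul_assoc _ (ENNReal.ofReal (Real.exp (-(T - 1 - 1)))),
      ← ENNReal.ofReal_mul (Real.exp_nonneg _), ← Real.exp_add,
      show -(T - 1 - 1) + |τ| = -(T - 1 - 1 - |τ|) by ring]
  have hfinal := lintegral_le_of_unit_intervals ((hem.pow_const 2).mul ham) hunit ht
  have hQt : Q t ⊆ Q (T - 1) := Q_mono (by linarith)
  calc energy U f (Q t) = ∫⁻ x in Q t, 2 * ‖D x‖ₑ ^ 2 := by
        refine lintegral_congr_ae ?_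
        filter_upwards [ae_mono (Measure.restrict_mono hQt le_rfl) hDae,
          ae_mono (Measure.restrict_mono hQt le_rfl) hconf] with x hx1 hx2
        rw [gradSq_eq_two_mul hx2, hx1, ENNReal.ofReal_mul (by norm_num), ofReal_norm_sq]
        simp
    _ = 2 * ∫⁻ s in Icc (-t) t, a s := by
        rw [lintegral_const_mul _ hD2m]
        congr 1
        exact (setLIntegral_strip hD2m _).symm
    _ = 2 * ∫⁻ s in Icc (-t) t, e s ^ 2 * a s := by
        congr 1
        refine setLIntegral_congr_fun measurableSet_Icc fun s hs => ?_
        have : η s = 1 := hηeq s (by rw [abs_le]; constructor <;> linarith [hs.1, hs.2])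
        simp [he, this]
    _ ≤ _ := by gcongr; exact hfinal

end WillmoreCyl

end

/-! ### Choice of constants and conclusion -/

theorem mainTheorem8 (n : ℕ) (p : ENNReal) (hp1 : 1 < p) (hp2 : p < 2) :
    ∃ C : ℝ, 0 < C ∧ ∀ ε₀ : ℝ, 0 < ε₀ → ∃ ε₂ : ℝ, 0 < ε₂ ∧ ε₂ < ε₀ ∧
      ∀ (R T : ℝ), 0 < R → 1 ≤ T →
      ∀ f : WillmoreCyl.Cyl → EuclideanSpace ℝ (Fin n),
        WillmoreCyl.MemFConf p (WillmoreCyl.Qo T) R f →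
      ∀ ε : ℝ, 0 < ε → ε ^ 2 ≤ ε₂ ^ 2 →
        (⨆ t ∈ Set.Icc (-T) (T - 1),
          WillmoreCyl.willmore (WillmoreCyl.Qo T) f (Set.univ ×ˢ Set.Icc t (t + 1)))
            < ENNReal.ofReal (ε ^ 2) →
      ∀ t ∈ Set.Icc (0 : ℝ) T,
        WillmoreCyl.energy (WillmoreCyl.Qo T) f (WillmoreCyl.Q t) ≤
          ENNReal.ofReal C * WillmoreCyl.energy (WillmoreCyl.Qo T) f (WillmoreCyl.Q T) *
            ENNReal.ofReal (Real.exp (-(1 - C * ε) * (T - t))) ∧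
        (WillmoreCyl.energy (WillmoreCyl.Qo T) f (WillmoreCyl.Q T) ≠ 0 →
          WillmoreCyl.energy (WillmoreCyl.Qo T) f (WillmoreCyl.Q T) ≠ ⊤ →
          WillmoreCyl.energy (WillmoreCyl.Qo T) f (WillmoreCyl.Q t) <
            ENNReal.ofReal C * WillmoreCyl.energy (WillmoreCyl.Qo T) f (WillmoreCyl.Q T) *
              ENNReal.ofReal (Real.exp (-(1 - C * ε) * (T - t)))) := by
  obtain ⟨K, hK⟩ := WillmoreCyl.exists_cutoff
  set Dc := WillmoreCyl.decayConst n (1 - 1 / p.toReal) K with hDc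
  have hDtop : Dc ≠ ⊤ := WillmoreCyl.decayConst_ne_top _ _ _
  set X : ENNReal := (4 * n) * WillmoreCyl.morreyConst (1 - 1 / p.toReal) with hX
  have hXtop : X ≠ ⊤ := ENNReal.mul_ne_top (ENNReal.mul_ne_top (by simp) (by simp))
    (WillmoreCyl.morreyConst_ne_top _)
  have hX0 : 0 ≤ X.toReal := ENNReal.toReal_nonneg
  -- The first summand collects the factors of the decay estimate for `t ≤ T - 2`. The second covers
  -- `t > T - 2`, where `e³ e^{-(T-t)} ≥ 1` and monotonicity of the energy is enough.
  set c₁ : ℝ := 4 * Real.exp 3 * Dc.toReal + Real.exp 3 with hc₁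
  have hc₁0 : 0 < c₁ := by positivity
  -- Doubling `c₁` gives the strict inequality when the right side is positive and finite.
  refine ⟨2 * c₁, by positivity, fun ε₀ hε₀ => ?_⟩
  -- Since `r ≤ 1`, `ε² ≤ r² ≤ r`, and then `4Xε² ≤ 1/2`, which is the absorption condition with `δ
  -- = ε²`.
  set r : ℝ := 1 / (8 * (X.toReal + 1)) with hr
  have hr0 : 0 < r := by positivity
  have hr1 : r ≤ 1 := by
    rw [hr, div_le_one (by positivity)]; linarith
  refine ⟨min (ε₀ / 2) r, by positivity, (min_le_left _ _).trans_lt (by linarith), ?_⟩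
  intro R T _ hT f hf ε hε hεle hW t ht
  set E := WillmoreCyl.energy (WillmoreCyl.Qo T) f (WillmoreCyl.Q T) with hE
  have hmono : WillmoreCyl.energy (WillmoreCyl.Qo T) f (WillmoreCyl.Q t) ≤ E :=
    WillmoreCyl.energy_mono _ _ (WillmoreCyl.Q_mono ht.2)
  have hexp : ENNReal.ofReal (Real.exp (-(T - t))) ≤
      ENNReal.ofReal (Real.exp (-(1 - 2 * c₁ * ε) * (T - t))) := by
    refine ENNReal.ofReal_le_ofReal (Real.exp_le_exp.2 ?_)
    have : 0 ≤ 2 * c₁ * ε * (T - t) := mul_nonneg (by positivity) (by linarith [ht.2])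
    linarith
  have hexp0 : ENNReal.ofReal (Real.exp (-(1 - 2 * c₁ * ε) * (T - t))) ≠ 0 := by
    simpa using Real.exp_pos _
  -- For infinite energy the right side is infinite, as its other factors are nonzero.
  rcases eq_or_ne E ⊤ with hEtop | hEtop
  · refine ⟨?_, fun _ h => absurd hEtop h⟩
    rw [hEtop, ENNReal.mul_top (by simpa using hc₁0), ENNReal.top_mul hexp0]
    exact le_top
  have key : WillmoreCyl.energy (WillmoreCyl.Qo T) f (WillmoreCyl.Q t) ≤
      ENNReal.ofReal c₁ * E * ENNReal.ofReal (Real.exp (-(T - t))) := by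
    rcases le_or_gt t (T - 2) with htT | htT
    · obtain ⟨η, h1, h2, h3, h4, h5⟩ := hK (T - 1)
      have hsmall : (4 * n) * WillmoreCyl.morreyConst (1 - 1 / p.toReal) *
          (2 * (2 * ENNReal.ofReal (ε ^ 2))) ≤ 1 / 2 := by
        rw [← hX, ← ENNReal.ofReal_toReal hXtop]
        have e4 : (2 : ENNReal) * (2 * ENNReal.ofReal (ε ^ 2)) = ENNReal.ofReal (4 * ε ^ 2) := by
          rw [← mul_assoc, ENNReal.ofReal_mul (by norm_num)]; norm_num
        have e2 : (1 / 2 : ENNReal) = ENNReal.ofReal (1 / 2) := by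
          rw [ENNReal.ofReal_div_of_pos (by norm_num)]; simp
        rw [e4, e2, ← ENNReal.ofReal_mul hX0]
        refine ENNReal.ofReal_le_ofReal ?_
        have hεr : ε ^ 2 ≤ r := by
          have hm : min (ε₀ / 2) r ≤ r := min_le_right _ _
          have hm0 : 0 ≤ min (ε₀ / 2) r := by positivity
          nlinarith
        have hrX : r * (8 * (X.toReal + 1)) = 1 := by rw [hr]; field_simp
        nlinarith
      have h := WillmoreCyl.energy_decay hp1 hp2 hT h1 h2 h3 h4 h5 hf hEtop
        (δ := ε ^ 2) (fun s hs => (le_iSup₂_of_le s hs le_rfl).trans hW.le) hsmall ht.1 htT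
      refine h.trans ?_
      rw [← hDc, ← hE, ← ENNReal.ofReal_toReal hDtop]
      calc 2 * (ENNReal.ofReal Dc.toReal * E * ENNReal.ofReal (Real.exp (-(T - 1 - 1))) *
            ENNReal.ofReal (2 * Real.exp (t + 1)))
          = ENNReal.ofReal (4 * Real.exp 3 * Dc.toReal) * E *
            ENNReal.ofReal (Real.exp (-(T - t))) := by
            have e : Real.exp (-(T - 1 - 1)) * Real.exp (t + 1)
                = Real.exp 3 * Real.exp (-(T - t)) := by
              rw [← Real.exp_add, ← Real.exp_add]; congr 1; ring
            have e' : ENNReal.ofReal (Real.exp (-(T - 1 - 1))) * ENNReal.ofReal (Real.exp (t + 1))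
                = ENNReal.ofReal (Real.exp 3) * ENNReal.ofReal (Real.exp (-(T - t))) := by
              rw [← ENNReal.ofReal_mul (Real.exp_nonneg _), e,
                ENNReal.ofReal_mul (Real.exp_nonneg _)]
            rw [ENNReal.ofReal_mul (p := 2) (by norm_num), ENNReal.ofReal_mul (by positivity),
              ENNReal.ofReal_mul (by norm_num)]
            have e2 : ENNReal.ofReal 2 = 2 := by norm_num
            have e4 : ENNReal.ofReal 4 = 4 := by norm_num
            rw [e2, e4]
            calc _ = 4 * ENNReal.ofReal Dc.toReal * E * (ENNReal.ofReal (Real.exp (-(T - 1 - 1)))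
                  * ENNReal.ofReal (Real.exp (t + 1))) := by ring
              _ = _ := by rw [e']; ring
        _ ≤ _ := by
            gcongr
            rw [hc₁]; linarith [Real.exp_pos 3]
    · refine hmono.trans ?_
      have h1 : 1 ≤ ENNReal.ofReal c₁ * ENNReal.ofReal (Real.exp (-(T - t))) := by
        rw [← ENNReal.ofReal_mul hc₁0.le, ENNReal.one_le_ofReal]
        have h2 : (1 : ℝ) ≤ Real.exp 3 * Real.exp (-(T - t)) := by
          rw [← Real.exp_add]; exact Real.one_le_exp (by linarith)
        have h3 : Real.exp 3 ≤ c₁ := by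
          rw [hc₁]
          have : 0 ≤ 4 * Real.exp 3 * Dc.toReal := by positivity
          linarith
        exact h2.trans (mul_le_mul_of_nonneg_right h3 (Real.exp_nonneg _))
      calc E = 1 * E := (one_mul _).symm
        _ ≤ ENNReal.ofReal c₁ * ENNReal.ofReal (Real.exp (-(T - t))) * E := by gcongr
        _ = _ := by ring
  have key' : WillmoreCyl.energy (WillmoreCyl.Qo T) f (WillmoreCyl.Q t) ≤
      ENNReal.ofReal c₁ * E * ENNReal.ofReal (Real.exp (-(1 - 2 * c₁ * ε) * (T - t))) :=
    key.trans (by gcongr)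
  have htwo : ENNReal.ofReal (2 * c₁) * E * ENNReal.ofReal (Real.exp (-(1 - 2 * c₁ * ε) * (T - t)))
      = 2 * (ENNReal.ofReal c₁ * E *
        ENNReal.ofReal (Real.exp (-(1 - 2 * c₁ * ε) * (T - t)))) := by
    rw [ENNReal.ofReal_mul (by norm_num)]
    norm_num
    ring
  rw [htwo, two_mul]
  refine ⟨key'.trans le_self_add, fun hE0 _ => key'.trans_lt ?_⟩
  refine ENNReal.lt_add_right ?_ ?_
  · exact ENNReal.mul_ne_top (ENNReal.mul_ne_top ENNReal.ofReal_ne_top hEtop)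
      ENNReal.ofReal_ne_top
  · exact mul_ne_zero (mul_ne_zero (by simpa using hc₁0) hE0) hexp0
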